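/- **Theorem (Solution of the Euler–Darboux equation in a triangle).** Let $D=\{(x,y)\in\mathbb R^2 : x\ge 0,\ y\ge 0,\ x+y<1\}$. Given real-valued functions $V_0,V_1$ on $[0,1)$ and an integer $m\ge 0$, a function $V:D\to\mathbb R$ is called a *$C^m$-solution of the Goursat problem in $D$ with data $\{V_0,V_1\}$* if there is an $\alpha\in[0,1)$ such that: * $V\in C(D)\cap C^m(\operatorname{Int} D)$; * the partial derivatives $V_x$, $V_y$, $V_{xy}=\partial_y(\partial_x V)$ exist in $\operatorname{Int}D$ and $$V_{xy}-\frac{V_x+V_y}{2(1-x-y)}=0\qquad\text{in }\operatorname{Int}D;$$ * the functions $x^\alpha V_x$, $y^\alpha V_y$ and $x^\alpha y^\alpha V_{xy}$ on $\operatorname{Int}D$ extend to continuous functions on $D$; * $V(x,0)=V_0(x)$ for all $x\in[0,1)$ and $V(0,y)=V_1(y)$ for all $y\in[0,1)$. Let $n\ge 2$ be an integer and $\alpha\in[0,1)$. Let $V_0,V_1\in C([0,1))\cap C^n((0,1))$ be real-valued functions with $V_0(0)=V_1(0)=0$ such that the functions $x^\alpha V_0'(x)$, $x^{\alpha+1}V_0''(x)$,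 $y^\alpha V_1'(y)$, $y^{\alpha+1}V_1''(y)$ on $(0,1)$ extend to continuous functions on $[0,1)$. Then all integrals in the formula $$V(x,y)=\frac1\pi\int_0^x\frac{\sqrt{1-k}}{\sqrt{(1-y-k)(x-k)}}\left(\int_0^k\frac{V_0'(x')}{\sqrt{k-x'}}\,dx'\right)dk+\frac1\pi\int_{1-y}^1\frac{\sqrt{k}}{\sqrt{(k-(1-y))(k-x)}}\left(\int_0^{1-k}\frac{V_1'(y')}{\sqrt{1-y'-k}}\,dy'\right)dk$$ converge absolutely for every $(x,y)\in D$, and $V$ is a $C^{n-1}$-solution of the Goursat problem in $D$ with data $\{V_0,V_1\}$, the conditions above being satisfied with the given $\alpha$. Furthermore, $V$ is the only solution: if $W$ is a $C^m$-solution of the Goursat problem in $D$ with data $\{V_0,V_1\}$ for some integer $m\ge 0$ (with any exponent in $[0,1)$), then $W=V$ on $D$. -/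

import Mathlib

open Set

noncomputable section

namespace EulerDarboux

/-- The triangle `D = {(x, y) | x ≥ 0, y ≥ 0, x + y < 1}`. -/
def triangle : Set (ℝ × ℝ) := {p | 0 ≤ p.1 ∧ 0 ≤ p.2 ∧ p.1 + p.2 < 1}

/-- `f`, considered on `U` only, extends to a continuous function on the larger set `S`. -/
def ExtendsContinuously {X : Type*} [TopologicalSpace X] (f : X → ℝ) (U S : Set X) : Prop :=
  ∃ g : X → ℝ, ContinuousOn g S ∧ EqOn g f U

/-- The partial derivative `V_x`. -/
def dx (V : ℝ × ℝ → ℝ) (p : ℝ × ℝ) : ℝ := deriv (fun s => V (s, p.2)) p.1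

/-- The partial derivative `V_y`. -/
def dy (V : ℝ × ℝ → ℝ) (p : ℝ × ℝ) : ℝ := deriv (fun t => V (p.1, t)) p.2

/-- The mixed partial derivative `V_xy`. -/
def dxy (V : ℝ × ℝ → ℝ) (p : ℝ × ℝ) : ℝ := dy (dx V) p

/-- `V` is a `C^m`-solution, with weight exponent `α`, of the Goursat problem for
`V_xy - (V_x + V_y) / (2 (1 - x - y)) = 0` in the triangle with data `V₀`, `V₁`.
Only the values of `V` on the triangle and of `V₀`, `V₁` on `[0, 1)` matter. -/
structure IsGoursatSolutionWith (m : ℕ) (α : ℝ) (V₀ V₁ : ℝ → ℝ) (V : ℝ × ℝ → ℝ) : Prop where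
  continuousOn : ContinuousOn V triangle
  contDiffOn : ContDiffOn ℝ m V (interior triangle)
  exists_dx : ∀ p ∈ interior triangle, DifferentiableAt ℝ (fun s => V (s, p.2)) p.1
  exists_dy : ∀ p ∈ interior triangle, DifferentiableAt ℝ (fun t => V (p.1, t)) p.2
  exists_dxy : ∀ p ∈ interior triangle, DifferentiableAt ℝ (fun t => dx V (p.1, t)) p.2
  equation : ∀ p ∈ interior triangle,
    dxy V p - (dx V p + dy V p) / (2 * (1 - p.1 - p.2)) = 0
  weighted_dx : ExtendsContinuously (fun p : ℝ × ℝ => p.1 ^ α * dx V p)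
    (interior triangle) triangle
  weighted_dy : ExtendsContinuously (fun p : ℝ × ℝ => p.2 ^ α * dy V p)
    (interior triangle) triangle
  weighted_dxy : ExtendsContinuously (fun p : ℝ × ℝ => p.1 ^ α * p.2 ^ α * dxy V p)
    (interior triangle) triangle
  boundary_x : ∀ x ∈ Ico (0 : ℝ) 1, V (x, 0) = V₀ x
  boundary_y : ∀ y ∈ Ico (0 : ℝ) 1, V (0, y) = V₁ y

/-- `V` is a `C^m`-solution of the Goursat problem with data `V₀`, `V₁`. -/
def IsGoursatSolution (m : ℕ) (V₀ V₁ : ℝ → ℝ) (V : ℝ × ℝ → ℝ) : Prop :=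
  ∃ α ∈ Ico (0 : ℝ) 1, IsGoursatSolutionWith m α V₀ V₁ V

/-- The assumptions on each of the two boundary functions. -/
structure IsAdmissibleData (n : ℕ) (α : ℝ) (v : ℝ → ℝ) : Prop where
  continuousOn : ContinuousOn v (Ico 0 1)
  contDiffOn : ContDiffOn ℝ n v (Ioo 0 1)
  weighted_deriv : ExtendsContinuously (fun x : ℝ => x ^ α * deriv v x) (Ioo 0 1) (Ico 0 1)
  weighted_deriv_two : ExtendsContinuously (fun x : ℝ => x ^ (α + 1) * deriv (deriv v) x)
    (Ioo 0 1) (Ico 0 1)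
  zero : v 0 = 0

/-- The integrand of the inner integral in the first term. -/
def inner₀ (V₀ : ℝ → ℝ) (k x' : ℝ) : ℝ := deriv V₀ x' / √(k - x')

/-- The integrand of the inner integral in the second term. -/
def inner₁ (V₁ : ℝ → ℝ) (k y' : ℝ) : ℝ := deriv V₁ y' / √(1 - y' - k)

/-- The integrand of the outer integral in the first term. -/
def outer₀ (V₀ : ℝ → ℝ) (x y k : ℝ) : ℝ :=
  √(1 - k) / √((1 - y - k) * (x - k)) * ∫ x' in (0 : ℝ)..k, inner₀ V₀ k x'

/-- The integrand of the outer integral in the second term. -/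
def outer₁ (V₁ : ℝ → ℝ) (x y k : ℝ) : ℝ :=
  √k / √((k - (1 - y)) * (k - x)) * ∫ y' in (0 : ℝ)..(1 - k), inner₁ V₁ k y'

/-- The double Abel integral formula. -/
def abelFormula (V₀ V₁ : ℝ → ℝ) (p : ℝ × ℝ) : ℝ :=
  1 / Real.pi * (∫ k in (0 : ℝ)..p.1, outer₀ V₀ p.1 p.2 k)
    + 1 / Real.pi * (∫ k in (1 - p.2)..1, outer₁ V₁ p.1 p.2 k)

/-- All the integrals in the double Abel integral formula converge absolutely, at every point
of the triangle. -/
structure AbelFormulaConverges (V₀ V₁ : ℝ → ℝ) : Prop where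
  integrable_inner₀ : ∀ k ∈ Ico (0 : ℝ) 1, IntervalIntegrable (inner₀ V₀ k) MeasureTheory.volume 0 k
  integrable_inner₁ : ∀ k ∈ Ioc (0 : ℝ) 1, IntervalIntegrable (inner₁ V₁ k) MeasureTheory.volume 0 (1 - k)
  integrable_outer₀ : ∀ p ∈ triangle,
    IntervalIntegrable (outer₀ V₀ p.1 p.2) MeasureTheory.volume 0 p.1
  integrable_outer₁ : ∀ p ∈ triangle,
    IntervalIntegrable (outer₁ V₁ p.1 p.2) MeasureTheory.volume (1 - p.2) 1

end EulerDarboux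

end

/-! Swapping the order of integration turns the double Abel formula into single integrals, `V(x,y) =
∫₀ˣ V₀'(s) K(x,y,s) ds + ∫₀ʸ V₁'(s) K(y,x,s) ds`, where `π K(x,y,s)` is the integral over `s < k <
x` of `√(1-k) / √((1-y-k)(x-k)(k-s))`. The substitution `k = s + (x-s) sin²θ` removes both endpoint
singularities: `K` becomes an average, over a fixed interval of `θ`, of the smooth function
`√(1-k)/√(1-y-k)`, and is therefore smooth across the diagonal `s = x`.

Existence rests on three properties of `K`. It satisfies the Euler–Darboux equation in `(x,y)`,
because the defect of the equation is the integral of an exact `θ`-derivative (`kernel_equation`).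
It equals `1` at `y = 0`, which gives the boundary values (`kernel_zero`). On the diagonal it
satisfies `2(1-x-y) K_y = K`, which cancels the terms produced by the moving upper limit
(`kernel_diag`, `two_mul_profileY`). The singularity `x^(-α)` of the data is handled by rescaling `s
= x t`, or by splitting the integral away from `0`.

For uniqueness, let `Z` be the difference of two solutions. On a vertical line `√(1-x-y) Z_x - Z /
(2√(1-x-y))` has `y`-derivative `-Z / (4(1-x-y)^(3/2))` and vanishes at `y = 0`. Hence `Z_x` is
bounded by a multiple of the supremum of `|Z|` below the point (`abs_dx_le`), and an exponentially
weighted maximum over a rectangle forces `Z = 0` (`eqOn_zero_of_homogeneous`). -/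

noncomputable section

open MeasureTheory Filter Topology

/-! ### Integrals of an integrable weight times a function regular in a parameter. -/

section ParametricIntegral

variable {X E F : Type} [TopologicalSpace X] [NormedAddCommGroup F]

/-- Tube lemma: the bound on the slice at `x₀`, enlarged by `1`, persists near each point of the
slice, and compactness of `K` makes the neighbourhood uniform. This supplies the dominating
functions below. -/
theorem eventually_forall_norm_le_of_continuousOn_prod {g : X → ℝ → F} {S : Set X} {K : Set ℝ}
    (hK : IsCompact K) (hg : ContinuousOn (Function.uncurry g) (S ×ˢ K)) {x₀ : X} (hx₀ : x₀ ∈ S) :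
    ∃ C, ∀ᶠ x in 𝓝[S] x₀, ∀ t ∈ K, ‖g x t‖ ≤ C := by
  have h0 : ContinuousOn (fun t => g x₀ t) K :=
    hg.comp (f := fun t => (x₀, t)) (by fun_prop) (fun t ht => ⟨hx₀, ht⟩)
  obtain ⟨C, hC⟩ := hK.exists_bound_of_continuousOn h0
  refine ⟨C + 1, ?_⟩
  have key : ∀ᶠ x in 𝓝 x₀, ∀ t ∈ K, x ∈ S → t ∈ K → ‖g x t‖ ≤ C + 1 := by
    refine hK.eventually_forall_of_forall_eventually (fun t ht => ?_)
    have h1 := (hg (x₀, t) ⟨hx₀, ht⟩).norm.eventually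
      (gt_mem_nhds (lt_of_le_of_lt (hC t ht) (lt_add_one C)))
    rw [eventually_nhdsWithin_iff] at h1
    filter_upwards [h1] with z hz h2 h3
    exact (hz ⟨h2, h3⟩).le
  rw [eventually_nhdsWithin_iff]
  filter_upwards [key] with x hx hxS t ht
  exact hx t ht hxS ht

variable [NormedAddCommGroup E] [NormedSpace ℝ E] [NormedSpace ℝ F]

theorem aestronglyMeasurable_smul_of_continuousOn {w : ℝ → ℝ} {g : ℝ → F} {a b : ℝ} (hab : a ≤ b)
    (hw : IntervalIntegrable w volume a b) (hg : ContinuousOn g (Icc a b)) :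
    AEStronglyMeasurable (fun t => w t • g t) (volume.restrict (uIoc a b)) := by
  rw [uIoc_of_le hab]
  refine (hw.1.aestronglyMeasurable).smul ?_
  exact (hg.mono Ioc_subset_Icc_self).aestronglyMeasurable measurableSet_Ioc

theorem continuousOn_integral_smul [FirstCountableTopology X] {w : ℝ → ℝ} {g : X → ℝ → F}
    {S : Set X} {a b : ℝ} (hab : a ≤ b)
    (hw : IntervalIntegrable w volume a b)
    (hg : ContinuousOn (Function.uncurry g) (S ×ˢ Icc a b)) :
    ContinuousOn (fun x => ∫ t in a..b, w t • g x t) S := by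
  intro x₀ hx₀
  obtain ⟨C, hC⟩ := eventually_forall_norm_le_of_continuousOn_prod isCompact_Icc hg hx₀
  refine intervalIntegral.continuousWithinAt_of_dominated_interval
    (bound := fun t => ‖w t‖ * C) ?_ ?_ ?_ ?_
  · filter_upwards [self_mem_nhdsWithin] with x hx
    exact aestronglyMeasurable_smul_of_continuousOn hab hw
      (hg.comp (f := fun t => (x, t)) (by fun_prop) (fun t ht => ⟨hx, ht⟩))
  · filter_upwards [hC] with x hx
    refine ae_of_all _ fun t ht => ?_
    rw [uIoc_of_le hab] at ht
    rw [norm_smul]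
    gcongr
    exact hx t (Ioc_subset_Icc_self ht)
  · exact hw.norm.mul_const C
  · refine ae_of_all _ fun t ht => ?_
    rw [uIoc_of_le hab] at ht
    exact (((hg (x₀, t) ⟨hx₀, Ioc_subset_Icc_self ht⟩).comp (f := fun x => (x, t))
      (by fun_prop) (fun x hx => ⟨hx, Ioc_subset_Icc_self ht⟩))).const_smul _

theorem hasFDerivAt_integral_smul {w : ℝ → ℝ} {g : E → ℝ → F} {g' : E → ℝ → E →L[ℝ] F}
    {U : Set E} (hU : IsOpen U) {a b : ℝ} (hab : a ≤ b)
    (hw : IntervalIntegrable w volume a b)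
    (hg : ContinuousOn (Function.uncurry g) (U ×ˢ Icc a b))
    (hg' : ContinuousOn (Function.uncurry g') (U ×ˢ Icc a b))
    (hd : ∀ x ∈ U, ∀ t ∈ Icc a b, HasFDerivAt (fun y => g y t) (g' x t) x)
    {x₀ : E} (hx₀ : x₀ ∈ U) :
    HasFDerivAt (fun x => ∫ t in a..b, w t • g x t) (∫ t in a..b, w t • g' x₀ t) x₀ := by
  obtain ⟨C, hC⟩ := eventually_forall_norm_le_of_continuousOn_prod isCompact_Icc hg' hx₀
  rw [hU.nhdsWithin_eq hx₀] at hC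
  have hsec : ∀ x ∈ U, ContinuousOn (g x) (Icc a b) := fun x hx =>
    hg.comp (f := fun t => (x, t)) (by fun_prop) (fun t ht => ⟨hx, ht⟩)
  refine intervalIntegral.hasFDerivAt_integral_of_dominated_of_fderiv_le
    (F' := fun x t => w t • g' x t)
    (bound := fun t => ‖w t‖ * C) (inter_mem hC (hU.mem_nhds hx₀)) ?_ ?_ ?_ ?_ ?_ ?_
  · filter_upwards [hU.mem_nhds hx₀] with x hx
    exact aestronglyMeasurable_smul_of_continuousOn hab hw (hsec x hx)
  · refine hw.smul_continuousOn ?_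
    rw [uIcc_of_le hab]
    exact hsec x₀ hx₀
  · exact aestronglyMeasurable_smul_of_continuousOn hab hw
      (hg'.comp (f := fun t => (x₀, t)) (by fun_prop) (fun t ht => ⟨hx₀, ht⟩))
  · refine ae_of_all _ fun t ht x hx => ?_
    rw [uIoc_of_le hab] at ht
    rw [norm_smul]
    gcongr
    exact hx.1 t (Ioc_subset_Icc_self ht)
  · exact hw.norm.mul_const C
  · refine ae_of_all _ fun t ht x hx => ?_
    rw [uIoc_of_le hab] at ht
    exact (hd x hx.2 t (Ioc_subset_Icc_self ht)).const_smul _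

theorem hasDerivAt_integral_smul {w : ℝ → ℝ} {g : ℝ → ℝ → F} {g' : ℝ → ℝ → F}
    {U : Set ℝ} (hU : IsOpen U) {a b : ℝ} (hab : a ≤ b)
    (hw : IntervalIntegrable w volume a b)
    (hg : ContinuousOn (Function.uncurry g) (U ×ˢ Icc a b))
    (hg' : ContinuousOn (Function.uncurry g') (U ×ˢ Icc a b))
    (hd : ∀ x ∈ U, ∀ t ∈ Icc a b, HasDerivAt (fun y => g y t) (g' x t) x)
    {x₀ : ℝ} (hx₀ : x₀ ∈ U) :
    HasDerivAt (fun x => ∫ t in a..b, w t • g x t) (∫ t in a..b, w t • g' x₀ t) x₀ := by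
  have hc : ContinuousOn (fun t => g' x₀ t) (Icc a b) :=
    hg'.comp (f := fun t => (x₀, t)) (by fun_prop) (fun t ht => ⟨hx₀, ht⟩)
  obtain ⟨C, hC⟩ := eventually_forall_norm_le_of_continuousOn_prod isCompact_Icc hg' hx₀
  rw [hU.nhdsWithin_eq hx₀] at hC
  have hsec : ∀ x ∈ U, ContinuousOn (g x) (Icc a b) := fun x hx =>
    hg.comp (f := fun t => (x, t)) (by fun_prop) (fun t ht => ⟨hx, ht⟩)
  refine (intervalIntegral.hasDerivAt_integral_of_dominated_loc_of_deriv_le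
    (F' := fun x t => w t • g' x t)
    (bound := fun t => ‖w t‖ * C) (inter_mem hC (hU.mem_nhds hx₀)) ?_ ?_ ?_ ?_ ?_ ?_).2
  · filter_upwards [hU.mem_nhds hx₀] with x hx
    exact aestronglyMeasurable_smul_of_continuousOn hab hw (hsec x hx)
  · refine hw.smul_continuousOn ?_
    rw [uIcc_of_le hab]
    exact hsec x₀ hx₀
  · exact aestronglyMeasurable_smul_of_continuousOn hab hw hc
  · refine ae_of_all _ fun t ht x hx => ?_
    rw [uIoc_of_le hab] at ht
    rw [norm_smul]
    gcongr
    exact hx.1 t (Ioc_subset_Icc_self ht)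
  · exact hw.norm.mul_const C
  · refine ae_of_all _ fun t ht x hx => ?_
    rw [uIoc_of_le hab] at ht
    exact (hd x hx.2 t (Ioc_subset_Icc_self ht)).const_smul _

/-- Induction on `m` by differentiating under the integral sign. The target `F` is quantified inside
the induction because the derivative takes values in `E →L[ℝ] F`; the open set `O` makes the full
derivative of `g` available up to the endpoints `a` and `b`. -/
theorem contDiffOn_integral_smul {w : ℝ → ℝ} {a b : ℝ} (hab : a ≤ b)
    (hw : IntervalIntegrable w volume a b) {U : Set E} (hU : IsOpen U) {O : Set (E × ℝ)}
    (hO : IsOpen O) (hUO : U ×ˢ Icc a b ⊆ O) (m : ℕ) :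
    ∀ {F : Type} [NormedAddCommGroup F] [NormedSpace ℝ F] {g : E → ℝ → F},
      ContDiffOn ℝ m (Function.uncurry g) O →
      ContDiffOn ℝ m (fun x => ∫ t in a..b, w t • g x t) U := by
  induction m with
  | zero =>
    intro F _ _ g hg
    simp only [Nat.cast_zero, contDiffOn_zero] at hg ⊢
    exact continuousOn_integral_smul hab hw (hg.mono hUO)
  | succ m ih =>
    intro F _ _ g hg
    have hg1 : DifferentiableOn ℝ (Function.uncurry g) O := hg.differentiableOn (by simp)
    rw [Nat.cast_succ, contDiffOn_succ_iff_fderiv_of_isOpen hO] at hg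
    let g' : E → ℝ → E →L[ℝ] F := fun x t =>
      (fderiv ℝ (Function.uncurry g) (x, t)).comp (ContinuousLinearMap.inl ℝ E ℝ)
    have hg'c : ContDiffOn ℝ m (Function.uncurry g') O := by
      have : ContDiffOn ℝ m (fun p : E × ℝ => (fderiv ℝ (Function.uncurry g) p).comp
          (ContinuousLinearMap.inl ℝ E ℝ)) O := hg.2.2.clm_comp contDiffOn_const
      exact this
    have hderiv : ∀ x ∈ U, HasFDerivAt (fun x => ∫ t in a..b, w t • g x t)
        (∫ t in a..b, w t • g' x t) x := by
      intro x hx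
      refine hasFDerivAt_integral_smul hU hab hw (hg1.continuousOn.mono hUO)
        (hg'c.continuousOn.mono hUO) (fun y hy t ht => ?_) hx
      have h1 := (hg1.differentiableAt (hO.mem_nhds (hUO (⟨hy, ht⟩ : (y, t) ∈ U ×ˢ Icc a b)))).hasFDerivAt
      have h2 : HasFDerivAt (fun z : E => (z, t)) (ContinuousLinearMap.inl ℝ E ℝ) y :=
        hasFDerivAt_prodMk_left y t
      exact HasFDerivAt.comp (g := Function.uncurry g) y h1 h2
    rw [Nat.cast_succ, contDiffOn_succ_iff_fderiv_of_isOpen hU]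
    refine ⟨fun x hx => (hderiv x hx).differentiableAt.differentiableWithinAt, by simp, ?_⟩
    exact (ih hg'c).congr (fun x hx => (hderiv x hx).fderiv)

end ParametricIntegral

namespace EulerDarboux

/-! ### The factor `√(1 - k) / √(1 - y - k)` and its derivatives. -/

/-- The pairs `(k, y)` with `k < 1` and `k + y < 1`. -/
def profileDomain : Set (ℝ × ℝ) := {p | p.1 < 1 ∧ p.1 + p.2 < 1}

/-- The triples `(x, y, s)` such that `(x, y)` and `(s, y)` lie in `profileDomain`. -/
def kernelDomain : Set (ℝ × ℝ × ℝ) :=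
  {q | q.1 < 1 ∧ q.2.2 < 1 ∧ q.1 + q.2.1 < 1 ∧ q.2.2 + q.2.1 < 1}

theorem isOpen_kernelDomain : IsOpen kernelDomain := by
  simp only [kernelDomain, ofPred_and]
  exact (isOpen_lt (by fun_prop) (by fun_prop)).inter <|
    (isOpen_lt (by fun_prop) (by fun_prop)).inter <|
    (isOpen_lt (by fun_prop) (by fun_prop)).inter (isOpen_lt (by fun_prop) (by fun_prop))

/-- The factor `√(1 - k) / √(1 - y - k)` of the Abel integrand. -/
def profile (p : ℝ × ℝ) : ℝ := √(1 - p.1) / √(1 - p.2 - p.1)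

/-- The derivative of `profile` in `k`. -/
def profileK (p : ℝ × ℝ) : ℝ := p.2 / (2 * √(1 - p.1) * ((1 - p.2 - p.1) * √(1 - p.2 - p.1)))

/-- The derivative of `profile` in `y`. -/
def profileY (p : ℝ × ℝ) : ℝ := √(1 - p.1) / (2 * ((1 - p.2 - p.1) * √(1 - p.2 - p.1)))

/-- The mixed derivative of `profile`. -/
def profileKY (p : ℝ × ℝ) : ℝ :=
  (2 * (1 - p.2 - p.1) + 3 * p.2) / (4 * √(1 - p.1) * ((1 - p.2 - p.1) ^ 2 * √(1 - p.2 - p.1)))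

section Profile

variable {p : ℝ × ℝ} {k y : ℝ}

theorem contDiffAt_sqrt_fst (hp : p ∈ profileDomain) (m : ℕ) :
    ContDiffAt ℝ m (fun p : ℝ × ℝ => √(1 - p.1)) p :=
  ContDiffAt.sqrt (by fun_prop) (by have := hp.1; linarith)

theorem contDiffAt_sqrt_sub (hp : p ∈ profileDomain) (m : ℕ) :
    ContDiffAt ℝ m (fun p : ℝ × ℝ => √(1 - p.2 - p.1)) p :=
  ContDiffAt.sqrt (by fun_prop) (by have := hp.2; linarith)

theorem profileDomain_pos (hp : p ∈ profileDomain) :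
    0 < 1 - p.2 - p.1 ∧ 0 < √(1 - p.1) ∧ 0 < √(1 - p.2 - p.1) := by
  have := hp.1
  have := hp.2
  refine ⟨by linarith, Real.sqrt_pos.2 (by linarith), Real.sqrt_pos.2 (by linarith)⟩

theorem contDiffOn_profile (m : ℕ) : ContDiffOn ℝ m profile profileDomain := fun _ hp =>
  ((contDiffAt_sqrt_fst hp m).div (contDiffAt_sqrt_sub hp m)
    (profileDomain_pos hp).2.2.ne').contDiffWithinAt

theorem contDiffOn_profileK (m : ℕ) : ContDiffOn ℝ m profileK profileDomain := fun _ hp => by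
  obtain ⟨h1, h2, h3⟩ := profileDomain_pos hp
  exact (ContDiffAt.div (by fun_prop) ((contDiffAt_const.mul (contDiffAt_sqrt_fst hp m)).mul
    ((by fun_prop : ContDiffAt ℝ m (fun p : ℝ × ℝ => 1 - p.2 - p.1) _).mul
      (contDiffAt_sqrt_sub hp m))) (by positivity)).contDiffWithinAt

theorem contDiffOn_profileY (m : ℕ) : ContDiffOn ℝ m profileY profileDomain := fun _ hp => by
  obtain ⟨h1, h2, h3⟩ := profileDomain_pos hp
  exact (ContDiffAt.div (contDiffAt_sqrt_fst hp m) (contDiffAt_const.mul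
    ((by fun_prop : ContDiffAt ℝ m (fun p : ℝ × ℝ => 1 - p.2 - p.1) _).mul
      (contDiffAt_sqrt_sub hp m))) (by positivity)).contDiffWithinAt

theorem contDiffOn_profileKY (m : ℕ) : ContDiffOn ℝ m profileKY profileDomain := fun _ hp => by
  obtain ⟨h1, h2, h3⟩ := profileDomain_pos hp
  exact (ContDiffAt.div (by fun_prop) ((contDiffAt_const.mul (contDiffAt_sqrt_fst hp m)).mul
    ((by fun_prop : ContDiffAt ℝ m (fun p : ℝ × ℝ => (1 - p.2 - p.1) ^ 2) _).mul
      (contDiffAt_sqrt_sub hp m))) (by positivity)).contDiffWithinAt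

theorem hasDerivAt_profile_fst (hp : (k, y) ∈ profileDomain) :
    HasDerivAt (fun k => profile (k, y)) (profileK (k, y)) k := by
  obtain ⟨h1, h2, h3⟩ := profileDomain_pos hp
  have e1 : √(1 - k) ^ 2 = 1 - k := Real.sq_sqrt (by have := hp.1; simp at this; linarith)
  have e2 : √(1 - y - k) ^ 2 = 1 - y - k := Real.sq_sqrt h1.le
  dsimp only at h1 h2 h3
  refine ((((hasDerivAt_id k).const_sub 1).sqrt (Real.sqrt_pos.1 h2).ne').div
    (((hasDerivAt_id k).const_sub (1 - y)).sqrt h1.ne') h3.ne').congr_deriv ?_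
  simp only [profileK, id]
  rw [e2]
  set A := √(1 - k)
  set B := √(1 - y - k)
  have hk : 1 - k = A ^ 2 := e1.symm
  have hyk : 1 - y - k = B ^ 2 := e2.symm
  -- With `k` and `y` expressed through the two roots, the claim is a rational identity in `A` and
  -- `B`.
  have hy : y = A ^ 2 - B ^ 2 := by linarith
  rw [hyk, hy]
  field_simp
  ring

theorem hasDerivAt_profile_snd (hp : (k, y) ∈ profileDomain) :
    HasDerivAt (fun y => profile (k, y)) (profileY (k, y)) y := by
  obtain ⟨h1, h2, h3⟩ := profileDomain_pos hp
  have e2 : √(1 - y - k) ^ 2 = 1 - y - k := Real.sq_sqrt h1.le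
  dsimp only at h1 h2 h3
  refine ((hasDerivAt_const y √(1 - k)).div
    ((((hasDerivAt_id y).const_sub 1).sub_const k).sqrt h1.ne') h3.ne').congr_deriv ?_
  simp only [profileY, id]
  rw [e2]
  field_simp
  ring

theorem hasDerivAt_profileK_snd (hp : (k, y) ∈ profileDomain) :
    HasDerivAt (fun y => profileK (k, y)) (profileKY (k, y)) y := by
  obtain ⟨h1, h2, h3⟩ := profileDomain_pos hp
  have e2 : √(1 - y - k) ^ 2 = 1 - y - k := Real.sq_sqrt h1.le
  dsimp only at h1 h2 h3
  have hb := ((hasDerivAt_id y).const_sub 1).sub_const k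
  refine ((hasDerivAt_id y).div ((hb.mul (hb.sqrt h1.ne')).const_mul (2 * √(1 - k)))
    (by simp only [id, Pi.mul_apply]; positivity)).congr_deriv ?_
  simp only [profileKY, id, Pi.mul_apply]
  set A := √(1 - k)
  set B := √(1 - y - k)
  rw [← e2]
  field_simp
  ring

theorem hasDerivAt_profileY_fst (hp : (k, y) ∈ profileDomain) :
    HasDerivAt (fun k => profileY (k, y)) (profileKY (k, y)) k := by
  obtain ⟨h1, h2, h3⟩ := profileDomain_pos hp
  have e1 : √(1 - k) ^ 2 = 1 - k := Real.sq_sqrt (by have := hp.1; simp at this; linarith)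
  have e2 : √(1 - y - k) ^ 2 = 1 - y - k := Real.sq_sqrt h1.le
  dsimp only at h1 h2 h3
  have hb := (hasDerivAt_id k).const_sub (1 - y)
  refine ((((hasDerivAt_id k).const_sub 1).sqrt (Real.sqrt_pos.1 h2).ne').div
    ((hb.mul (hb.sqrt h1.ne')).const_mul 2)
    (by simp only [id, Pi.mul_apply]; positivity)).congr_deriv ?_
  simp only [profileKY, id, Pi.mul_apply]
  set A := √(1 - k)
  set B := √(1 - y - k)
  have hk : 1 - k = A ^ 2 := e1.symm
  have hyk : 1 - y - k = B ^ 2 := e2.symm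
  have hy : y = A ^ 2 - B ^ 2 := by linarith
  rw [hyk, hy]
  field_simp
  ring

/-- The differential relation between the derivatives of `profile` behind the Euler–Darboux
equation of the kernel. -/
theorem profileK_eq (hp : p ∈ profileDomain) :
    profileK p = 2 * (1 - p.2 - p.1) * profileKY p - 2 * profileY p := by
  obtain ⟨h1, h2, h3⟩ := profileDomain_pos hp
  have e1 : √(1 - p.1) ^ 2 = 1 - p.1 := Real.sq_sqrt (by have := hp.1; linarith)
  have e2 : √(1 - p.2 - p.1) ^ 2 = 1 - p.2 - p.1 := Real.sq_sqrt h1.le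
  simp only [profileK, profileKY, profileY]
  set A := √(1 - p.1)
  set B := √(1 - p.2 - p.1)
  have hyk : 1 - p.2 - p.1 = B ^ 2 := e2.symm
  have hy : p.2 = A ^ 2 - B ^ 2 := by linarith
  rw [hyk, hy]
  field_simp
  ring

/-- On the diagonal the kernel reduces to `profile`, so this identity is what cancels the boundary
terms in the equation for the solution. -/
theorem two_mul_profileY (hp : p ∈ profileDomain) :
    2 * (1 - p.1 - p.2) * profileY p = profile p := by
  obtain ⟨h1, h2, h3⟩ := profileDomain_pos hp
  rw [profile, profileY, sub_right_comm 1 p.1 p.2]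
  field_simp

end Profile

/-! ### Averages over the segment between `s` and `x`. -/

/-- The convex combination of `s` and `x` used to parametrize `[s, x]`. -/
def sinSqPath (s x θ : ℝ) : ℝ := s + (x - s) * Real.sin θ ^ 2

/-- The average of `φ(·, y)` over the segment from `s` to `x`, with respect to `w(θ) dθ`. -/
def segmentAverage (φ : ℝ × ℝ → ℝ) (w : ℝ → ℝ) (q : ℝ × ℝ × ℝ) : ℝ :=
  ∫ θ in (0 : ℝ)..(Real.pi / 2), w θ • φ (sinSqPath q.2.2 q.1 θ, q.2.1)

/-- The conditions defining the domain are upper bounds on `s` and `x`, hence stable under convex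
combinations. No order between `s` and `x` is needed, so `kernelDomain` is an open neighbourhood of
its diagonal points. -/
theorem sinSqPath_mem {x y s : ℝ} (h : (x, y, s) ∈ kernelDomain) (θ : ℝ) :
    (sinSqPath s x θ, y) ∈ profileDomain := by
  obtain ⟨h1, h2, h3, h4⟩ := h
  have hs := Real.sin_sq_le_one θ
  have h0 := sq_nonneg (Real.sin θ)
  dsimp only at h1 h2 h3 h4
  have e : ∀ c, s < c → x < c → sinSqPath s x θ < c := by
    intro c hsc hxc
    have : c - sinSqPath s x θ = (c - s) * (1 - Real.sin θ ^ 2) + (c - x) * Real.sin θ ^ 2 := by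
      simp only [sinSqPath]; ring
    rcases eq_or_lt_of_le hs with h | h
    · rw [h] at this; linarith
    · have h5 : 0 < (c - s) * (1 - Real.sin θ ^ 2) := mul_pos (by linarith) (by linarith)
      have h6 : 0 ≤ (c - x) * Real.sin θ ^ 2 := mul_nonneg (by linarith) h0
      linarith
  exact ⟨e 1 h2 h1, by have := e (1 - y) (by linarith) (by linarith); simp; linarith⟩

theorem contDiff_sinSqPath (m : ℕ) :
    ContDiff ℝ m (fun z : (ℝ × ℝ × ℝ) × ℝ => (sinSqPath z.1.2.2 z.1.1 z.2, z.1.2.1)) := by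
  unfold sinSqPath
  fun_prop

section Average

variable {φ φ' : ℝ × ℝ → ℝ} {w : ℝ → ℝ} {x y s : ℝ}

theorem half_pi_nonneg : 0 ≤ Real.pi / 2 := by positivity

theorem contDiffOn_segmentAverage (hw : Continuous w) (m : ℕ)
    (hφ : ContDiffOn ℝ m φ profileDomain) :
    ContDiffOn ℝ m (segmentAverage φ w) kernelDomain := by
  refine contDiffOn_integral_smul half_pi_nonneg (hw.intervalIntegrable _ _) isOpen_kernelDomain
    (O := kernelDomain ×ˢ univ) (isOpen_kernelDomain.prod isOpen_univ)
    (prod_mono_right (subset_univ _)) m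
    (g := fun q θ => φ (sinSqPath q.2.2 q.1 θ, q.2.1)) ?_
  exact hφ.comp (contDiff_sinSqPath m).contDiffOn (fun z hz => sinSqPath_mem hz.1 z.2)

theorem hasDerivAt_segmentAverage_fst (hw : Continuous w) (hφ : ContinuousOn φ profileDomain)
    (hφ' : ContinuousOn φ' profileDomain)
    (hd : ∀ k y, (k, y) ∈ profileDomain → HasDerivAt (fun k => φ (k, y)) (φ' (k, y)) k)
    (h : (x, y, s) ∈ kernelDomain) :
    HasDerivAt (fun x => segmentAverage φ w (x, y, s))
      (segmentAverage φ' (fun θ => w θ * Real.sin θ ^ 2) (x, y, s)) x := by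
  have hU : IsOpen {x : ℝ | (x, y, s) ∈ kernelDomain} :=
    isOpen_kernelDomain.preimage (by fun_prop)
  have hpath : Continuous (fun z : ℝ × ℝ => (sinSqPath s z.1 z.2, y)) := by
    unfold sinSqPath; fun_prop
  have key := hasDerivAt_integral_smul (w := w) (g := fun x θ => φ (sinSqPath s x θ, y))
    (g' := fun x θ => φ' (sinSqPath s x θ, y) * Real.sin θ ^ 2) hU half_pi_nonneg
    (hw.intervalIntegrable _ _)
    (hφ.comp hpath.continuousOn (fun z hz => sinSqPath_mem hz.1 z.2))
    ((hφ'.comp hpath.continuousOn (fun z hz => sinSqPath_mem hz.1 z.2)).mul (by fun_prop))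
    (fun x hx θ _ => by
      have h2 : HasDerivAt (fun x => sinSqPath s x θ) (Real.sin θ ^ 2) x := by
        simpa [sinSqPath] using ((((hasDerivAt_id x).sub_const s).mul_const (Real.sin θ ^ 2)).const_add s)
      exact (hd _ _ (sinSqPath_mem hx θ)).comp x h2) h
  refine key.congr_deriv ?_
  simp only [segmentAverage, smul_eq_mul]
  congr 1
  ext θ
  ring

theorem hasDerivAt_segmentAverage_snd (hw : Continuous w) (hφ : ContinuousOn φ profileDomain)
    (hφ' : ContinuousOn φ' profileDomain)
    (hd : ∀ k y, (k, y) ∈ profileDomain → HasDerivAt (fun y => φ (k, y)) (φ' (k, y)) y)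
    (h : (x, y, s) ∈ kernelDomain) :
    HasDerivAt (fun y => segmentAverage φ w (x, y, s)) (segmentAverage φ' w (x, y, s)) y := by
  have hU : IsOpen {y : ℝ | (x, y, s) ∈ kernelDomain} :=
    isOpen_kernelDomain.preimage (by fun_prop)
  have hpath : Continuous (fun z : ℝ × ℝ => (sinSqPath s x z.2, z.1)) := by
    unfold sinSqPath; fun_prop
  exact hasDerivAt_integral_smul (w := w) (g := fun y θ => φ (sinSqPath s x θ, y))
    (g' := fun y θ => φ' (sinSqPath s x θ, y)) hU half_pi_nonneg
    (hw.intervalIntegrable _ _)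
    (hφ.comp hpath.continuousOn (fun z hz => sinSqPath_mem hz.1 z.2))
    (hφ'.comp hpath.continuousOn (fun z hz => sinSqPath_mem hz.1 z.2))
    (fun y hy θ _ => hd _ _ (sinSqPath_mem hy θ)) h

end Average

/-! ### The kernel and its Euler–Darboux equation. -/

/-- The Riemann-type kernel of the Abel formula. -/
def kernel : ℝ × ℝ × ℝ → ℝ := segmentAverage profile (fun _ => 2 / Real.pi)

/-- The derivative of `kernel` in `x`. -/
def kernelX : ℝ × ℝ × ℝ → ℝ :=
  segmentAverage profileK (fun θ => 2 / Real.pi * Real.sin θ ^ 2)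

/-- The derivative of `kernel` in `y`. -/
def kernelY : ℝ × ℝ × ℝ → ℝ := segmentAverage profileY (fun _ => 2 / Real.pi)

/-- The mixed derivative of `kernel`. -/
def kernelXY : ℝ × ℝ × ℝ → ℝ :=
  segmentAverage profileKY (fun θ => 2 / Real.pi * Real.sin θ ^ 2)

section Kernel

variable {x y s : ℝ}

theorem contDiffOn_kernel (m : ℕ) : ContDiffOn ℝ m kernel kernelDomain :=
  contDiffOn_segmentAverage (by fun_prop) m (contDiffOn_profile m)

theorem contDiffOn_kernelX (m : ℕ) : ContDiffOn ℝ m kernelX kernelDomain :=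
  contDiffOn_segmentAverage (by fun_prop) m (contDiffOn_profileK m)

theorem contDiffOn_kernelY (m : ℕ) : ContDiffOn ℝ m kernelY kernelDomain :=
  contDiffOn_segmentAverage (by fun_prop) m (contDiffOn_profileY m)

theorem contDiffOn_kernelXY (m : ℕ) : ContDiffOn ℝ m kernelXY kernelDomain :=
  contDiffOn_segmentAverage (by fun_prop) m (contDiffOn_profileKY m)

theorem hasDerivAt_kernel_fst (h : (x, y, s) ∈ kernelDomain) :
    HasDerivAt (fun x => kernel (x, y, s)) (kernelX (x, y, s)) x :=
  hasDerivAt_segmentAverage_fst (by fun_prop) (contDiffOn_profile 0).continuousOn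
    (contDiffOn_profileK 0).continuousOn (fun _ _ hp => hasDerivAt_profile_fst hp) h

theorem hasDerivAt_kernel_snd (h : (x, y, s) ∈ kernelDomain) :
    HasDerivAt (fun y => kernel (x, y, s)) (kernelY (x, y, s)) y :=
  hasDerivAt_segmentAverage_snd (by fun_prop) (contDiffOn_profile 0).continuousOn
    (contDiffOn_profileY 0).continuousOn (fun _ _ hp => hasDerivAt_profile_snd hp) h

theorem hasDerivAt_kernelX_snd (h : (x, y, s) ∈ kernelDomain) :
    HasDerivAt (fun y => kernelX (x, y, s)) (kernelXY (x, y, s)) y :=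
  hasDerivAt_segmentAverage_snd (by fun_prop) (contDiffOn_profileK 0).continuousOn
    (contDiffOn_profileKY 0).continuousOn (fun _ _ hp => hasDerivAt_profileK_snd hp) h

theorem hasDerivAt_kernelY_fst (h : (x, y, s) ∈ kernelDomain) :
    HasDerivAt (fun x => kernelY (x, y, s)) (kernelXY (x, y, s)) x :=
  hasDerivAt_segmentAverage_fst (by fun_prop) (contDiffOn_profileY 0).continuousOn
    (contDiffOn_profileKY 0).continuousOn (fun _ _ hp => hasDerivAt_profileY_fst hp) h

/-- For `s = x` the path is constant, and `2 / π` gives the interval `[0, π/2]` total mass `1`. -/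
theorem kernel_diag (x y : ℝ) : kernel (x, y, x) = profile (x, y) := by
  simp only [kernel, segmentAverage, sinSqPath, sub_self, zero_mul, add_zero,
    intervalIntegral.integral_const, smul_eq_mul]
  field_simp [Real.pi_ne_zero]
  ring

theorem kernelY_diag (x y : ℝ) : kernelY (x, y, x) = profileY (x, y) := by
  simp only [kernelY, segmentAverage, sinSqPath, sub_self, zero_mul, add_zero,
    intervalIntegral.integral_const, smul_eq_mul]
  field_simp [Real.pi_ne_zero]
  ring

theorem kernel_zero (h : (x, 0, s) ∈ kernelDomain) : kernel (x, 0, s) = 1 := by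
  have : ∀ θ, profile (sinSqPath s x θ, 0) = 1 := fun θ => by
    have := (profileDomain_pos (sinSqPath_mem h θ)).2.1
    simp only [profile, sub_zero] at this ⊢
    exact div_self this.ne'
  simp only [kernel, segmentAverage, this, intervalIntegral.integral_const, smul_eq_mul]
  field_simp [Real.pi_ne_zero]
  ring

/-- By `profileK_eq`, the difference of the two sides is the integral of the `θ`-derivative of
`-(2/π) sin θ cos θ · profileY`, and this function vanishes at `0` and `π/2`. -/
theorem kernel_equation (h : (x, y, s) ∈ kernelDomain) :
    2 * (1 - x - y) * kernelXY (x, y, s) = kernelX (x, y, s) + kernelY (x, y, s) := by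
  have hpath : Continuous (fun θ : ℝ => (sinSqPath s x θ, y)) := by
    unfold sinSqPath; fun_prop
  have cont : ∀ φ : ℝ × ℝ → ℝ, ContinuousOn φ profileDomain → ∀ w : ℝ → ℝ, Continuous w →
      IntervalIntegrable (fun θ => w θ • φ (sinSqPath s x θ, y)) volume 0 (Real.pi / 2) := by
    intro φ hφ w hw
    have : Continuous (fun θ => φ (sinSqPath s x θ, y)) :=
      hφ.comp_continuous hpath (fun θ => sinSqPath_mem h θ)
    exact (hw.smul this).intervalIntegrable _ _
  have i1 := cont profileK (contDiffOn_profileK 0).continuousOn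
    (fun θ => 2 / Real.pi * Real.sin θ ^ 2) (by fun_prop)
  have i2 := cont profileY (contDiffOn_profileY 0).continuousOn (fun _ => 2 / Real.pi) (by fun_prop)
  have i3 := cont profileKY (contDiffOn_profileKY 0).continuousOn
    (fun θ => 2 / Real.pi * Real.sin θ ^ 2) (by fun_prop)
  have ftc := intervalIntegral.integral_eq_sub_of_hasDerivAt (a := 0) (b := Real.pi / 2)
    (f := fun θ => -(2 / Real.pi) * (Real.sin θ * Real.cos θ * profileY (sinSqPath s x θ, y)))
    (f' := fun θ => 2 * (1 - x - y) *
        ((2 / Real.pi * Real.sin θ ^ 2) • profileKY (sinSqPath s x θ, y))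
      - ((2 / Real.pi * Real.sin θ ^ 2) • profileK (sinSqPath s x θ, y)
        + (2 / Real.pi) • profileY (sinSqPath s x θ, y)))
    (fun θ _ => by
      have hp := sinSqPath_mem h θ
      have h1 : HasDerivAt (fun θ => sinSqPath s x θ)
          ((x - s) * (2 * Real.sin θ * Real.cos θ)) θ := by
        simpa [sinSqPath] using (((Real.hasDerivAt_sin θ).pow 2).const_mul (x - s)).const_add s
      have h2 := (((Real.hasDerivAt_sin θ).mul (Real.hasDerivAt_cos θ)).mul
        ((hasDerivAt_profileY_fst hp).comp θ h1)).const_mul (-(2 / Real.pi))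
      refine h2.congr_deriv ?_
      rw [profileK_eq hp]
      have hc : Real.cos θ ^ 2 = 1 - Real.sin θ ^ 2 := Real.cos_sq' θ
      simp only [smul_eq_mul, Function.comp, Pi.mul_apply]
      generalize profileKY (sinSqPath s x θ, y) = A
      generalize profileY (sinSqPath s x θ, y) = B
      simp only [sinSqPath]
      linear_combination (-(2 / Real.pi) * (B + 2 * (x - s) * Real.sin θ ^ 2 * A)) * hc)
    ((i3.const_mul _).sub (i1.add i2))
  rw [intervalIntegral.integral_sub (i3.const_mul _) (i1.add i2),
    intervalIntegral.integral_add i1 i2, intervalIntegral.integral_const_mul] at ftc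
  simp only [Real.sin_zero, Real.cos_pi_div_two, mul_zero, zero_mul, sub_zero] at ftc
  exact sub_eq_zero.1 ftc

end Kernel

/-! ### Integrals of a weighted continuous density against a kernel. -/

/-- The function `x ^ α * f x` on `(0, 1)` extends continuously to `[0, 1)`. -/
def IsWeightedContinuous (α : ℝ) (f : ℝ → ℝ) : Prop :=
  ExtendsContinuously (fun x : ℝ => x ^ α * f x) (Ioo 0 1) (Ico 0 1)

/-- The integral of `f s * G (x, y, s)` over `0 ≤ s ≤ x`. -/
def kernelIntegral (f : ℝ → ℝ) (G : ℝ × ℝ × ℝ → ℝ) (p : ℝ × ℝ) : ℝ :=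
  ∫ s in (0 : ℝ)..p.1, f s • G (p.1, p.2, s)

theorem interior_triangle :
    interior triangle = {p : ℝ × ℝ | 0 < p.1 ∧ 0 < p.2 ∧ p.1 + p.2 < 1} := by
  apply Subset.antisymm
  · intro p hp
    have h1 : interior triangle ⊆ interior (Ici (0 : ℝ) ×ˢ Ici (0 : ℝ)) :=
      interior_mono fun q hq => ⟨hq.1, hq.2.1⟩
    have h2 := h1 hp
    rw [interior_prod_eq, interior_Ici] at h2
    exact ⟨h2.1, h2.2, (interior_subset hp).2.2⟩
  · refine interior_maximal (fun p hp => ⟨hp.1.le, hp.2.1.le, hp.2.2⟩) ?_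
    simp only [ofPred_and]
    exact (isOpen_lt (by fun_prop) (by fun_prop)).inter <|
      (isOpen_lt (by fun_prop) (by fun_prop)).inter (isOpen_lt (by fun_prop) (by fun_prop))

theorem mem_interior_triangle {p : ℝ × ℝ} :
    p ∈ interior triangle ↔ 0 < p.1 ∧ 0 < p.2 ∧ p.1 + p.2 < 1 := by
  rw [interior_triangle]; rfl

theorem mem_kernelDomain_of_mem_triangle {x y s : ℝ} (hp : (x, y) ∈ triangle) (hs : s ≤ x) :
    (x, y, s) ∈ kernelDomain := by
  obtain ⟨h1, h2, h3⟩ := hp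
  dsimp only at h1 h2 h3
  refine ⟨?_, ?_, ?_, ?_⟩ <;> dsimp only <;> linarith

section Density

variable {α : ℝ} {f : ℝ → ℝ} {G : ℝ × ℝ × ℝ → ℝ}

theorem IsWeightedContinuous.exists_eq_rpow_mul (hf : IsWeightedContinuous α f) :
    ∃ g : ℝ → ℝ, ContinuousOn g (Ico 0 1) ∧ ∀ x ∈ Ioo (0 : ℝ) 1, f x = x ^ (-α) * g x := by
  obtain ⟨g, hg, he⟩ := hf
  refine ⟨g, hg, fun x hx => ?_⟩
  rw [he hx, ← mul_assoc, ← Real.rpow_add hx.1]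
  simp

theorem IsWeightedContinuous.intervalIntegrable (hα : α < 1) (hf : IsWeightedContinuous α f)
    {a : ℝ} (h0 : 0 ≤ a) (h1 : a < 1) : IntervalIntegrable f volume 0 a := by
  obtain ⟨g, hg, he⟩ := hf.exists_eq_rpow_mul
  have h2 : IntervalIntegrable (fun x : ℝ => x ^ (-α) * g x) volume 0 a := by
    refine (intervalIntegral.intervalIntegrable_rpow' (by linarith)).mul_continuousOn ?_
    rw [uIcc_of_le h0]
    exact hg.mono fun x hx => ⟨hx.1, hx.2.trans_lt h1⟩
  refine h2.congr fun x hx => ?_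
  rw [uIoc_of_le h0] at hx
  exact (he x ⟨hx.1, hx.2.trans_lt h1⟩).symm

/-- Writing `f s = s^(-α) g s` and `s = x t` gives `x^(1-α)` times the integral over `[0,1]` of
`t^(-α) g(xt) G(x,y,xt)`. The weight is integrable and the rest continuous up to `x = 0`; the
prefactor vanishes there since `α < 1`. -/
theorem continuousOn_kernelIntegral (hα : α < 1) (hf : IsWeightedContinuous α f)
    (hG : ContinuousOn G kernelDomain) : ContinuousOn (kernelIntegral f G) triangle := by
  obtain ⟨g, hg, he⟩ := hf.exists_eq_rpow_mul
  have h1 : ContinuousOn (fun p : ℝ × ℝ => ∫ t in (0 : ℝ)..1, (t ^ (-α)) •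
      (g (p.1 * t) * G (p.1, p.2, p.1 * t))) triangle := by
    have hmem : ∀ z ∈ triangle ×ˢ Icc (0 : ℝ) 1, 0 ≤ z.1.1 * z.2 ∧ z.1.1 * z.2 ≤ z.1.1 :=
      fun z hz => ⟨mul_nonneg hz.1.1 hz.2.1, mul_le_of_le_one_right hz.1.1 hz.2.2⟩
    refine continuousOn_integral_smul zero_le_one
      (intervalIntegral.intervalIntegrable_rpow' (by linarith)) ?_
    refine ContinuousOn.mul ?_ ?_
    · refine hg.comp (f := fun z : (ℝ × ℝ) × ℝ => z.1.1 * z.2) (by fun_prop) fun z hz => ?_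
      have := hz.1.2.1
      have := hz.1.2.2
      exact ⟨(hmem z hz).1, (hmem z hz).2.trans_lt (by linarith)⟩
    · exact hG.comp (f := fun z : (ℝ × ℝ) × ℝ => (z.1.1, z.1.2, z.1.1 * z.2)) (by fun_prop)
        fun z hz => mem_kernelDomain_of_mem_triangle hz.1 (hmem z hz).2
  have h2 : ContinuousOn (fun p : ℝ × ℝ => p.1 ^ (1 - α)) triangle :=
    (continuous_fst.rpow_const fun p => Or.inr (by linarith)).continuousOn
  refine (h2.mul h1).congr fun p hp => ?_
  rcases eq_or_lt_of_le hp.1 with h0 | h0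
  · simp [kernelIntegral, ← h0, Real.zero_rpow (by linarith : 1 - α ≠ 0)]
  · have hlt : p.1 < 1 := by have := hp.2.1; have := hp.2.2; linarith
    have h3 := intervalIntegral.smul_integral_comp_mul_left (a := 0) (b := 1)
      (fun s => f s • G (p.1, p.2, s)) p.1
    rw [mul_zero, mul_one] at h3
    simp only [kernelIntegral]
    rw [← h3, smul_eq_mul, Pi.mul_apply, ← intervalIntegral.integral_const_mul,
      ← intervalIntegral.integral_const_mul]
    refine intervalIntegral.integral_congr_ae (ae_of_all _ fun t ht => ?_)
    rw [uIoc_of_le zero_le_one] at ht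
    have ht' : 0 < p.1 * t := mul_pos h0 ht.1
    have hle : p.1 * t ≤ p.1 := mul_le_of_le_one_right h0.le ht.2
    simp only [smul_eq_mul]
    rw [he (p.1 * t) ⟨ht', hle.trans_lt hlt⟩, Real.mul_rpow h0.le ht.1.le, sub_eq_add_neg,
      Real.rpow_add h0, Real.rpow_one]
    ring

/-- The set of triples `(x, y, a)` in `kernelDomain` with `a > b`. -/
def upperKernelDomain (b : ℝ) : Set (ℝ × ℝ × ℝ) := kernelDomain ∩ {q | b < q.2.2}

theorem isOpen_upperKernelDomain (b : ℝ) : IsOpen (upperKernelDomain b) :=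
  isOpen_kernelDomain.inter (isOpen_lt (by fun_prop) (by fun_prop))

theorem mem_kernelDomain_of_le {x y s a : ℝ} (h : (x, y, a) ∈ kernelDomain) (hs : s ≤ a) :
    (x, y, s) ∈ kernelDomain := by
  obtain ⟨h1, h2, h3, h4⟩ := h
  dsimp only at h1 h2 h3 h4
  refine ⟨?_, ?_, ?_, ?_⟩ <;> dsimp only <;> linarith

theorem continuousOn_kernel_section {x y a : ℝ} (hG : ContinuousOn G kernelDomain)
    (h : (x, y, a) ∈ kernelDomain) : ContinuousOn (fun s => G (x, y, s)) (Iic a) :=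
  hG.comp (f := fun s : ℝ => (x, y, s)) (by fun_prop) fun _ hs => mem_kernelDomain_of_le h hs

theorem intervalIntegrable_smul_kernel (hα : α < 1) (hf : IsWeightedContinuous α f)
    (hG : ContinuousOn G kernelDomain) {x y a : ℝ} (ha : 0 ≤ a) (h : (x, y, a) ∈ kernelDomain) :
    IntervalIntegrable (fun s => f s • G (x, y, s)) volume 0 a := by
  refine (hf.intervalIntegrable hα ha h.2.1).smul_continuousOn ?_
  rw [uIcc_of_le ha]
  exact (continuousOn_kernel_section hG h).mono fun s hs => hs.2

/-- The upper limit is a variable independent of `x`, so that the diagonal case follows by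
composition. The integral is split at `ε`: on `[0, ε]` the density is merely integrable, but only
`G` carries the parameters; on `[ε, a]` the density is itself `C^m`, and an affine change of
variable moves the limit `a` into the integrand. -/
theorem contDiffOn_primitive (hα : α < 1) (hf : IsWeightedContinuous α f) {m : ℕ}
    (hfm : ContDiffOn ℝ m f (Ioo 0 1)) (hG : ContDiffOn ℝ m G kernelDomain) :
    ContDiffOn ℝ m (fun q : ℝ × ℝ × ℝ => ∫ s in (0 : ℝ)..q.2.2, f s • G (q.1, q.2.1, s))
      (upperKernelDomain 0) := by
  intro q₀ hq₀
  have ha₀ : 0 < q₀.2.2 := hq₀.2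
  -- Half the upper limit at the base point, so that `ε` stays below the upper limit nearby.
  set ε := q₀.2.2 / 2 with hε
  have hεpos : 0 < ε := by positivity
  have hmem : q₀ ∈ upperKernelDomain ε := ⟨hq₀.1, by simp only [mem_ofPred]; linarith⟩
  have hε1 : ∀ q ∈ upperKernelDomain ε, ε < 1 := fun q hq => lt_trans hq.2 hq.1.2.1
  have c1 : ContDiffOn ℝ m (fun q : ℝ × ℝ × ℝ => ∫ s in (0 : ℝ)..ε, f s • G (q.1, q.2.1, s))
      (upperKernelDomain ε) := by
    refine contDiffOn_integral_smul hεpos.le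
      (hf.intervalIntegrable hα hεpos.le (hε1 _ hmem)) (isOpen_upperKernelDomain ε)
      (O := {z : (ℝ × ℝ × ℝ) × ℝ | (z.1.1, z.1.2.1, z.2) ∈ kernelDomain})
      (isOpen_kernelDomain.preimage (by fun_prop)) ?_ m
      (g := fun q s => G (q.1, q.2.1, s)) ?_
    · rintro ⟨⟨x, y, a⟩, s⟩ ⟨⟨h1, h2⟩, h3⟩
      exact mem_kernelDomain_of_le h1 (h3.2.trans (le_of_lt h2))
    · exact hG.comp (f := fun z : (ℝ × ℝ × ℝ) × ℝ => (z.1.1, z.1.2.1, z.2))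
        (by fun_prop) (fun z hz => hz)
  have c2 : ContDiffOn ℝ m (fun q : ℝ × ℝ × ℝ => ∫ t in (0 : ℝ)..1, (1 : ℝ) •
      (f (ε + (q.2.2 - ε) * t) * G (q.1, q.2.1, ε + (q.2.2 - ε) * t)))
      (upperKernelDomain ε) := by
    refine contDiffOn_integral_smul zero_le_one intervalIntegrable_const
      (isOpen_upperKernelDomain ε)
      (O := {z : (ℝ × ℝ × ℝ) × ℝ | ε + (z.1.2.2 - ε) * z.2 ∈ Ioo (0 : ℝ) 1} ∩
        {z : (ℝ × ℝ × ℝ) × ℝ | (z.1.1, z.1.2.1, ε + (z.1.2.2 - ε) * z.2) ∈ kernelDomain})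
      ((isOpen_Ioo.preimage (by fun_prop)).inter (isOpen_kernelDomain.preimage (by fun_prop)))
      ?_ m (g := fun q t => f (ε + (q.2.2 - ε) * t) * G (q.1, q.2.1, ε + (q.2.2 - ε) * t)) ?_
    · rintro ⟨⟨x, y, a⟩, t⟩ ⟨⟨h1, h2⟩, h3⟩
      have h2' : ε < a := h2
      have h4 : 0 ≤ (a - ε) * t := mul_nonneg (by linarith) h3.1
      have h5 : (a - ε) * t ≤ a - ε := mul_le_of_le_one_right (by linarith) h3.2
      have h6 : a < 1 := h1.2.1
      exact ⟨⟨by simp only; linarith, by simp only; linarith⟩,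
        mem_kernelDomain_of_le h1 (by simp only; linarith)⟩
    · refine ContDiffOn.mul ?_ ?_
      · exact hfm.comp (f := fun z : (ℝ × ℝ × ℝ) × ℝ => ε + (z.1.2.2 - ε) * z.2)
          (by fun_prop) (fun z hz => hz.1)
      · exact hG.comp (f := fun z : (ℝ × ℝ × ℝ) × ℝ =>
          (z.1.1, z.1.2.1, ε + (z.1.2.2 - ε) * z.2)) (by fun_prop) (fun z hz => hz.2)
  have c3 : ContDiffOn ℝ m (fun q : ℝ × ℝ × ℝ => ∫ s in (0 : ℝ)..q.2.2, f s • G (q.1, q.2.1, s))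
      (upperKernelDomain ε) := by
    have c4 : ContDiffOn ℝ m (fun q : ℝ × ℝ × ℝ => q.2.2 - ε) (upperKernelDomain ε) := by
      fun_prop
    refine (c1.add (c4.mul c2)).congr ?_
    rintro ⟨x, y, a⟩ ⟨h1, h2⟩
    have h2' : ε < a := h2
    have h3 := intervalIntegral.smul_integral_comp_add_mul (a := 0) (b := 1)
      (fun s => f s • G (x, y, s)) (a - ε) ε
    rw [mul_zero, add_zero, mul_one, add_sub_cancel] at h3
    have i1 := intervalIntegrable_smul_kernel hα hf hG.continuousOn hεpos.le
      (mem_kernelDomain_of_le h1 h2'.le)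
    have i2 := intervalIntegrable_smul_kernel hα hf hG.continuousOn
      (hεpos.le.trans h2'.le) h1
    have h4 := intervalIntegral.integral_add_adjacent_intervals i1 (i1.symm.trans i2)
    simp only [smul_eq_mul, one_mul] at h3 h4 ⊢
    rw [h3, h4]
  exact ((c3.contDiffAt ((isOpen_upperKernelDomain ε).mem_nhds hmem))).contDiffWithinAt

theorem contDiffOn_kernelIntegral (hα : α < 1) (hf : IsWeightedContinuous α f) {m : ℕ}
    (hfm : ContDiffOn ℝ m f (Ioo 0 1)) (hG : ContDiffOn ℝ m G kernelDomain) :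
    ContDiffOn ℝ m (kernelIntegral f G) (interior triangle) :=
  (contDiffOn_primitive hα hf hfm hG).comp (f := fun p : ℝ × ℝ => (p.1, p.2, p.1))
    (by fun_prop) fun _ hp => ⟨mem_kernelDomain_of_mem_triangle (interior_subset hp) le_rfl,
      (mem_interior_triangle.1 hp).1⟩

theorem hasDerivAt_primitive_fst (hα : α < 1) (hf : IsWeightedContinuous α f)
    {G' : ℝ × ℝ × ℝ → ℝ} (hG : ContinuousOn G kernelDomain) (hG' : ContinuousOn G' kernelDomain)
    (hd : ∀ x y s, (x, y, s) ∈ kernelDomain →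
      HasDerivAt (fun x => G (x, y, s)) (G' (x, y, s)) x)
    {x y a : ℝ} (ha : 0 ≤ a) (h : (x, y, a) ∈ kernelDomain) :
    HasDerivAt (fun x => ∫ s in (0 : ℝ)..a, f s • G (x, y, s))
      (∫ s in (0 : ℝ)..a, f s • G' (x, y, s)) x := by
  have hU : IsOpen {x : ℝ | (x, y, a) ∈ kernelDomain} :=
    isOpen_kernelDomain.preimage (by fun_prop)
  refine hasDerivAt_integral_smul (g := fun x s => G (x, y, s)) (g' := fun x s => G' (x, y, s))
    hU ha (hf.intervalIntegrable hα ha h.2.1) ?_ ?_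
    (fun x hx s hs => hd x y s (mem_kernelDomain_of_le hx hs.2)) h
  · exact hG.comp (f := fun z : ℝ × ℝ => (z.1, y, z.2)) (by fun_prop)
      fun z hz => mem_kernelDomain_of_le hz.1 hz.2.2
  · exact hG'.comp (f := fun z : ℝ × ℝ => (z.1, y, z.2)) (by fun_prop)
      fun z hz => mem_kernelDomain_of_le hz.1 hz.2.2

theorem hasDerivAt_primitive_snd (hα : α < 1) (hf : IsWeightedContinuous α f)
    {G' : ℝ × ℝ × ℝ → ℝ} (hG : ContinuousOn G kernelDomain) (hG' : ContinuousOn G' kernelDomain)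
    (hd : ∀ x y s, (x, y, s) ∈ kernelDomain →
      HasDerivAt (fun y => G (x, y, s)) (G' (x, y, s)) y)
    {x y a : ℝ} (ha : 0 ≤ a) (h : (x, y, a) ∈ kernelDomain) :
    HasDerivAt (fun y => ∫ s in (0 : ℝ)..a, f s • G (x, y, s))
      (∫ s in (0 : ℝ)..a, f s • G' (x, y, s)) y := by
  have hU : IsOpen {y : ℝ | (x, y, a) ∈ kernelDomain} :=
    isOpen_kernelDomain.preimage (by fun_prop)
  refine hasDerivAt_integral_smul (g := fun y s => G (x, y, s)) (g' := fun y s => G' (x, y, s))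
    hU ha (hf.intervalIntegrable hα ha h.2.1) ?_ ?_
    (fun y hy s hs => hd x y s (mem_kernelDomain_of_le hy hs.2)) h
  · exact hG.comp (f := fun z : ℝ × ℝ => (x, z.1, z.2)) (by fun_prop)
      fun z hz => mem_kernelDomain_of_le hz.1 hz.2.2
  · exact hG'.comp (f := fun z : ℝ × ℝ => (x, z.1, z.2)) (by fun_prop)
      fun z hz => mem_kernelDomain_of_le hz.1 hz.2.2

theorem hasDerivAt_primitive_upper (hα : α < 1) (hf : IsWeightedContinuous α f)
    (hfc : ContinuousOn f (Ioo 0 1)) (hG : ContinuousOn G kernelDomain)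
    {x y a : ℝ} (ha : 0 < a) (h : (x, y, a) ∈ kernelDomain) :
    HasDerivAt (fun a => ∫ s in (0 : ℝ)..a, f s • G (x, y, s)) (f a • G (x, y, a)) a := by
  have hopen : IsOpen (Ioo (0 : ℝ) 1 ∩ {s : ℝ | (x, y, s) ∈ kernelDomain}) :=
    isOpen_Ioo.inter (isOpen_kernelDomain.preimage (by fun_prop))
  have hc : ContinuousOn (fun s => f s • G (x, y, s))
      (Ioo (0 : ℝ) 1 ∩ {s : ℝ | (x, y, s) ∈ kernelDomain}) :=
    (hfc.mono inter_subset_left).smul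
      (hG.comp (f := fun s : ℝ => (x, y, s)) (by fun_prop) fun _ hs => hs.2)
  have hmem : a ∈ Ioo (0 : ℝ) 1 ∩ {s : ℝ | (x, y, s) ∈ kernelDomain} := ⟨⟨ha, h.2.1⟩, h⟩
  exact intervalIntegral.integral_hasDerivAt_right
    (intervalIntegrable_smul_kernel hα hf hG ha.le h)
    (hc.stronglyMeasurableAtFilter hopen a hmem) (hc.continuousAt (hopen.mem_nhds hmem))

theorem hasDerivAt_kernelIntegral_fst (hα : α < 1) (hf : IsWeightedContinuous α f)
    (hf1 : ContDiffOn ℝ 1 f (Ioo 0 1)) {G' : ℝ × ℝ × ℝ → ℝ} (hG : ContDiffOn ℝ 1 G kernelDomain)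
    (hG' : ContinuousOn G' kernelDomain)
    (hd : ∀ x y s, (x, y, s) ∈ kernelDomain →
      HasDerivAt (fun x => G (x, y, s)) (G' (x, y, s)) x)
    {x y : ℝ} (hp : (x, y) ∈ triangle) (hx : 0 < x) :
    HasDerivAt (fun x => kernelIntegral f G (x, y))
      (f x * G (x, y, x) + kernelIntegral f G' (x, y)) x := by
  have hmem := mem_kernelDomain_of_mem_triangle hp (le_refl x)
  have hdiff := (((contDiffOn_primitive (m := 1) hα hf (by simpa using hf1)
    (by simpa using hG)).contDiffAt ((isOpen_upperKernelDomain 0).mem_nhds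
      (⟨hmem, hx⟩ : (x, y, x) ∈ upperKernelDomain 0))).differentiableAt (by simp)).hasFDerivAt
  set L := fderiv ℝ (fun q : ℝ × ℝ × ℝ => ∫ s in (0 : ℝ)..q.2.2, f s • G (q.1, q.2.1, s)) (x, y, x)
  have h1 : HasDerivAt (fun t : ℝ => (t, y, x)) ((1 : ℝ), (0 : ℝ), (0 : ℝ)) x :=
    (hasDerivAt_id x).prodMk ((hasDerivAt_const x y).prodMk (hasDerivAt_const x x))
  have h2 : HasDerivAt (fun t : ℝ => (x, y, t)) ((0 : ℝ), (0 : ℝ), (1 : ℝ)) x :=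
    (hasDerivAt_const x x).prodMk ((hasDerivAt_const x y).prodMk (hasDerivAt_id x))
  have h3 : HasDerivAt (fun t : ℝ => (t, y, t)) ((1 : ℝ), (0 : ℝ), (1 : ℝ)) x :=
    (hasDerivAt_id x).prodMk ((hasDerivAt_const x y).prodMk (hasDerivAt_id x))
  have k1 := HasFDerivAt.comp_hasDerivAt (f := fun t : ℝ => (t, y, x)) x hdiff h1
  have k2 := HasFDerivAt.comp_hasDerivAt (f := fun t : ℝ => (x, y, t)) x hdiff h2
  have k3 := HasFDerivAt.comp_hasDerivAt (f := fun t : ℝ => (t, y, t)) x hdiff h3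
  have e1 := k1.unique
    (hasDerivAt_primitive_fst hα hf hG.continuousOn hG' hd hx.le hmem)
  have e2 := k2.unique
    (hasDerivAt_primitive_upper hα hf hf1.continuousOn hG.continuousOn hx hmem)
  refine k3.congr_deriv ?_
  -- Moving along the diagonal is the sum of moving the upper limit and moving `x` in the kernel;
  -- joint differentiability lets the two derivatives add.
  have : ((1 : ℝ), (0 : ℝ), (1 : ℝ)) = (0, 0, 1) + (1, 0, 0) := by simp
  rw [this, map_add, e1, e2]
  rfl

theorem hasDerivAt_kernelIntegral_snd (hα : α < 1) (hf : IsWeightedContinuous α f)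
    {G' : ℝ × ℝ × ℝ → ℝ} (hG : ContinuousOn G kernelDomain) (hG' : ContinuousOn G' kernelDomain)
    (hd : ∀ x y s, (x, y, s) ∈ kernelDomain →
      HasDerivAt (fun y => G (x, y, s)) (G' (x, y, s)) y)
    {x y : ℝ} (hp : (x, y) ∈ triangle) :
    HasDerivAt (fun y => kernelIntegral f G (x, y)) (kernelIntegral f G' (x, y)) y :=
  hasDerivAt_primitive_snd hα hf hG hG' hd hp.1
    (mem_kernelDomain_of_mem_triangle hp (le_refl x))

end Density

/-! ### The trigonometric substitution in the Abel integral. -/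

section Abel

variable {x s : ℝ}

theorem hasDerivAt_sinSqPath (s x θ : ℝ) :
    HasDerivAt (sinSqPath s x) ((x - s) * (2 * Real.sin θ * Real.cos θ)) θ := by
  have := (((Real.hasDerivAt_sin θ).pow 2).const_mul (x - s)).const_add s
  simp only [Nat.cast_ofNat, Nat.add_one_sub_one, pow_one] at this
  exact this

theorem continuous_sinSqPath (s x : ℝ) : Continuous (sinSqPath s x) := by
  unfold sinSqPath; fun_prop

theorem strictMonoOn_sinSqPath (h : s < x) : StrictMonoOn (sinSqPath s x) (Icc 0 (Real.pi / 2)) := by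
  refine strictMonoOn_of_deriv_pos (convex_Icc _ _) (continuous_sinSqPath s x).continuousOn ?_
  intro θ hθ
  rw [interior_Icc] at hθ
  rw [(hasDerivAt_sinSqPath s x θ).deriv]
  have h1 := Real.sin_pos_of_pos_of_lt_pi hθ.1 (by linarith [hθ.2, Real.pi_pos])
  have h2 := Real.cos_pos_of_mem_Ioo ⟨by linarith [hθ.1, Real.pi_pos], hθ.2⟩
  have := sub_pos.2 h
  positivity

theorem image_sinSqPath (h : s < x) : sinSqPath s x '' Ioo 0 (Real.pi / 2) = Ioo s x := by
  have e0 : sinSqPath s x 0 = s := by simp [sinSqPath]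
  have e1 : sinSqPath s x (Real.pi / 2) = x := by simp [sinSqPath]
  have hmono := strictMonoOn_sinSqPath h
  have hpi := half_pi_nonneg
  apply Subset.antisymm
  · rintro _ ⟨θ, hθ, rfl⟩
    constructor
    · have := hmono ⟨le_rfl, hpi⟩ (Ioo_subset_Icc_self hθ) hθ.1
      rwa [e0] at this
    · have := hmono (Ioo_subset_Icc_self hθ) ⟨hpi, le_rfl⟩ hθ.2
      rwa [e1] at this
  · have := intermediate_value_Ioo hpi (continuous_sinSqPath s x).continuousOn
    rwa [e0, e1] at this

/-- Along the path the root equals `(x - s) sin θ cos θ`, exactly half of `dk/dθ`, so the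
singularities cancel and leave the factor `2`. -/
theorem abel_substitution {φ : ℝ → ℝ} (h : s < x) (hφ : ContinuousOn φ (Icc s x)) :
    IntegrableOn (fun k => φ k / √((x - k) * (k - s))) (Ioo s x) ∧
    ∫ k in Ioo s x, φ k / √((x - k) * (k - s)) =
      ∫ θ in (0 : ℝ)..(Real.pi / 2), 2 * φ (sinSqPath s x θ) := by
  have hinj : InjOn (sinSqPath s x) (Ioo 0 (Real.pi / 2)) :=
    (strictMonoOn_sinSqPath h).injOn.mono Ioo_subset_Icc_self
  have hder : ∀ θ ∈ Ioo 0 (Real.pi / 2), HasDerivWithinAt (sinSqPath s x)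
      ((x - s) * (2 * Real.sin θ * Real.cos θ)) (Ioo 0 (Real.pi / 2)) θ :=
    fun θ _ => (hasDerivAt_sinSqPath s x θ).hasDerivWithinAt
  have heq : EqOn (fun θ => |(x - s) * (2 * Real.sin θ * Real.cos θ)| •
      (φ (sinSqPath s x θ) / √((x - sinSqPath s x θ) * (sinSqPath s x θ - s))))
      (fun θ => 2 * φ (sinSqPath s x θ)) (Ioo 0 (Real.pi / 2)) := by
    intro θ hθ
    have h1 := Real.sin_pos_of_pos_of_lt_pi hθ.1 (by linarith [hθ.2, Real.pi_pos])
    have h2 := Real.cos_pos_of_mem_Ioo ⟨by linarith [hθ.1, Real.pi_pos], hθ.2⟩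
    have h3 := sub_pos.2 h
    have h4 : (x - sinSqPath s x θ) * (sinSqPath s x θ - s) =
        ((x - s) * (Real.sin θ * Real.cos θ)) ^ 2 := by
      have hc : Real.cos θ ^ 2 = 1 - Real.sin θ ^ 2 := Real.cos_sq' θ
      rw [mul_pow, mul_pow, hc, sinSqPath]
      ring
    have h5 : 0 < (x - s) * (Real.sin θ * Real.cos θ) := by positivity
    have h6 : 0 < (x - s) * (2 * Real.sin θ * Real.cos θ) := by positivity
    dsimp only
    rw [h4, Real.sqrt_sq h5.le, abs_of_pos h6, smul_eq_mul]
    field_simp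
  have hcont : ContinuousOn (fun θ => 2 * φ (sinSqPath s x θ)) (Icc 0 (Real.pi / 2)) := by
    refine continuousOn_const.mul (hφ.comp (continuous_sinSqPath s x).continuousOn ?_)
    intro θ hθ
    have hs := Real.sin_sq_le_one θ
    have h0 := sq_nonneg (Real.sin θ)
    have h3 := sub_pos.2 h
    exact ⟨by simp only [sinSqPath]; nlinarith, by simp only [sinSqPath]; nlinarith⟩
  constructor
  · rw [← image_sinSqPath h, integrableOn_image_iff_integrableOn_abs_deriv_smul measurableSet_Ioo
      hder hinj]
    refine IntegrableOn.congr_fun ?_ heq.symm measurableSet_Ioo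
    exact hcont.integrableOn_Icc.mono_set Ioo_subset_Icc_self
  · rw [← image_sinSqPath h, integral_image_eq_integral_abs_deriv_smul measurableSet_Ioo
      hder hinj, setIntegral_congr_fun measurableSet_Ioo heq,
      intervalIntegral.integral_of_le half_pi_nonneg, integral_Ioc_eq_integral_Ioo]

/-- The weight in front of the inner integral in the Abel formula. -/
def outerWeight (x y k : ℝ) : ℝ := √(1 - k) / √((1 - y - k) * (x - k))

theorem outerWeight_nonneg (x y k : ℝ) : 0 ≤ outerWeight x y k := by
  unfold outerWeight; positivity

theorem measurable_outerWeight (x y : ℝ) : Measurable (outerWeight x y) := by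
  unfold outerWeight; fun_prop

theorem integral_outerWeight_div_sqrt {y : ℝ} (hp : (x, y) ∈ triangle) (hs : s ∈ Ioo 0 x) :
    IntegrableOn (fun k => outerWeight x y k / √(k - s)) (Ioo 0 x) ∧
    ∫ k in Ioo 0 x, outerWeight x y k / √(k - s) = Real.pi * kernel (x, y, s) := by
  have hxy : x + y < 1 := hp.2.2
  have hy : 0 ≤ y := hp.2.1
  have hcont : ContinuousOn (fun k => profile (k, y)) (Icc s x) := by
    refine (contDiffOn_profile 0).continuousOn.comp (f := fun k : ℝ => (k, y)) (by fun_prop) ?_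
    intro k hk
    have := hk.2
    exact ⟨by simp only; linarith, by simp only; linarith⟩
  obtain ⟨h1, h2⟩ := abel_substitution hs.2 hcont
  -- For `k ≤ s` the root is `0` and so is the quotient by it, hence integrating over `(0, x)` is
  -- the same as over `(s, x)`.
  have hzero : ∀ k ∈ Ioo 0 x \ Ioo s x, outerWeight x y k / √(k - s) = 0 := by
    intro k hk
    have : k ≤ s := by
      by_contra! hc
      exact hk.2 ⟨hc, hk.1.2⟩
    rw [Real.sqrt_eq_zero_of_nonpos (by linarith), div_zero]
  have heq : EqOn (fun k => profile (k, y) / √((x - k) * (k - s)))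
      (fun k => outerWeight x y k / √(k - s)) (Ioo s x) := by
    intro k hk
    have hk1 := hk.1
    have hk2 := hk.2
    simp only [profile, outerWeight]
    rw [Real.sqrt_mul (by linarith), Real.sqrt_mul (by linarith), div_div, div_div]
    ring
  have hsub : Ioo s x ⊆ Ioo 0 x := Ioo_subset_Ioo_left hs.1.le
  constructor
  · exact (h1.congr_fun heq measurableSet_Ioo).of_forall_sdiff_eq_zero measurableSet_Ioo hzero
  · rw [setIntegral_eq_of_subset_of_forall_sdiff_eq_zero measurableSet_Ioo hsub hzero,
      ← setIntegral_congr_fun measurableSet_Ioo heq, h2, kernel, segmentAverage,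
      ← intervalIntegral.integral_const_mul]
    congr 1
    ext θ
    rw [smul_eq_mul]
    field_simp [Real.pi_ne_zero]

end Abel

/-! ### Absolute convergence and reduction to single integrals. -/

section Fubini

variable {α : ℝ} {V₀ V₁ : ℝ → ℝ}

/-- The default values of root and division extend the integrand by zero, so that Fubini on the
region `s < k < x` can be carried out on the square `(0, x)²`. -/
theorem inner₀_eq_zero {k s : ℝ} (h : k ≤ s) : inner₀ V₀ k s = 0 := by
  rw [inner₀, Real.sqrt_eq_zero_of_nonpos (by linarith), div_zero]

/-- The singularity of the data at `0` and the Abel singularity at `k` are separated at `k / 2`; on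
each half one factor is continuous and the other integrable. -/
theorem intervalIntegrable_inner₀ (hα : α < 1) (hf : IsWeightedContinuous α (deriv V₀))
    (hfc : ContinuousOn (deriv V₀) (Ioo 0 1)) {k : ℝ} (hk : k ∈ Ico (0 : ℝ) 1) :
    IntervalIntegrable (inner₀ V₀ k) volume 0 k := by
  rcases eq_or_lt_of_le hk.1 with h0 | h0
  · rw [← h0]
  have i1 : IntervalIntegrable (inner₀ V₀ k) volume 0 (k / 2) := by
    have := (hf.intervalIntegrable hα (by positivity : 0 ≤ k / 2)
      (by linarith [hk.2])).mul_continuousOn (g := fun s => (√(k - s))⁻¹) ?_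
    · exact this
    · rw [uIcc_of_le (by positivity)]
      refine ContinuousOn.inv₀ (by fun_prop) fun s hs => ?_
      exact (Real.sqrt_pos.2 (by linarith [hs.2])).ne'
  have i2 : IntervalIntegrable (inner₀ V₀ k) volume (k / 2) k := by
    have h1 : IntervalIntegrable (fun s : ℝ => s ^ (-(1 / 2) : ℝ)) volume (k / 2) 0 :=
      intervalIntegral.intervalIntegrable_rpow' (by norm_num)
    have h2 := h1.comp_sub_left k
    rw [sub_zero, sub_half] at h2
    have h3 := h2.continuousOn_mul (g := deriv V₀) ?_
    · refine h3.congr fun s hs => ?_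
      rw [uIoc_of_le (by linarith)] at hs
      simp only [inner₀]
      rw [Real.rpow_neg (by linarith [hs.2]), ← Real.sqrt_eq_rpow, div_eq_mul_inv]
    · rw [uIcc_of_le (by linarith)]
      exact hfc.mono fun s hs => ⟨by linarith [hs.1], hs.2.trans_lt hk.2⟩
  exact i1.trans i2

theorem outer₀_eq (x y k : ℝ) :
    outer₀ V₀ x y k = outerWeight x y k * ∫ s in (0 : ℝ)..k, inner₀ V₀ k s := rfl

/-- Integrating first in `k` gives `π V₀'(s) K(x,y,s)`. As the outer weight is nonnegative, absolute
values give `π |V₀'(s)| K(x,y,s)`, integrable because `K` is continuous in `s` up to `x`; this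
justifies Fubini. -/
theorem integral_outer₀ (hα : α < 1) (hf : IsWeightedContinuous α (deriv V₀))
    {p : ℝ × ℝ} (hp : p ∈ triangle) :
    IntervalIntegrable (outer₀ V₀ p.1 p.2) volume 0 p.1 ∧
    ∫ k in (0 : ℝ)..p.1, outer₀ V₀ p.1 p.2 k = Real.pi * kernelIntegral (deriv V₀) kernel p := by
  obtain ⟨x, y⟩ := p
  have hx0 : 0 ≤ x := hp.1
  have hx1 : x < 1 := by
    have h1 : 0 ≤ y := hp.2.1
    have h2 : x + y < 1 := hp.2.2
    linarith
  dsimp only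
  set μ := volume.restrict (Ioo 0 x)
  have hmeas : AEStronglyMeasurable
      (Function.uncurry fun k s => outerWeight x y k * inner₀ V₀ k s) (μ.prod μ) := by
    refine Measurable.aestronglyMeasurable ?_
    refine ((measurable_outerWeight x y).comp measurable_fst).mul ?_
    exact ((measurable_deriv V₀).comp measurable_snd).div
      (Real.continuous_sqrt.measurable.comp (measurable_fst.sub measurable_snd))
  have hrw : ∀ k s, outerWeight x y k * inner₀ V₀ k s =
      deriv V₀ s * (outerWeight x y k / √(k - s)) := fun k s => by rw [inner₀]; ring
  have hint : Integrable
      (Function.uncurry fun k s => outerWeight x y k * inner₀ V₀ k s) (μ.prod μ) := by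
    rw [integrable_prod_iff' hmeas]
    constructor
    · refine (ae_restrict_iff' measurableSet_Ioo).2 (ae_of_all _ fun s hs => ?_)
      simp only [Function.uncurry_apply_pair, hrw]
      exact (integral_outerWeight_div_sqrt hp hs).1.const_mul _
    · have h1 : IntervalIntegrable (fun s => |deriv V₀ s| * (Real.pi * kernel (x, y, s)))
          volume 0 x := by
        refine (hf.intervalIntegrable hα hx0 hx1).abs.mul_continuousOn ?_
        rw [uIcc_of_le hx0]
        exact continuousOn_const.mul ((continuousOn_kernel_section
          (contDiffOn_kernel 0).continuousOn
          (mem_kernelDomain_of_mem_triangle hp le_rfl)).mono fun s hs => hs.2)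
      rw [intervalIntegrable_iff_integrableOn_Ioo_of_le hx0] at h1
      refine h1.congr_fun (fun s hs => ?_) measurableSet_Ioo
      simp only [Function.uncurry_apply_pair, hrw, norm_mul, Real.norm_eq_abs]
      rw [integral_const_mul, ← (integral_outerWeight_div_sqrt hp hs).2]
      congr 2
      ext k
      rw [abs_of_nonneg (div_nonneg (outerWeight_nonneg x y k) (Real.sqrt_nonneg _))]
  have hinner : EqOn (fun k => ∫ s in Ioo 0 x, outerWeight x y k * inner₀ V₀ k s)
      (outer₀ V₀ x y) (Ioo 0 x) := by
    intro k hk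
    dsimp only
    rw [integral_const_mul, outer₀_eq, intervalIntegral.integral_of_le hk.1.le,
      integral_Ioc_eq_integral_Ioo]
    congr 1
    refine setIntegral_eq_of_subset_of_forall_sdiff_eq_zero measurableSet_Ioo
      (Ioo_subset_Ioo_right hk.2.le) fun s hs => inner₀_eq_zero ?_
    by_contra! hc
    exact hs.2 ⟨hs.1.1, hc⟩
  constructor
  · rw [intervalIntegrable_iff_integrableOn_Ioo_of_le hx0]
    exact IntegrableOn.congr_fun hint.integral_prod_left hinner measurableSet_Ioo
  · rw [intervalIntegral.integral_of_le hx0, integral_Ioc_eq_integral_Ioo,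
      ← setIntegral_congr_fun measurableSet_Ioo hinner, integral_integral_swap hint,
      kernelIntegral, intervalIntegral.integral_of_le hx0, integral_Ioc_eq_integral_Ioo,
      ← integral_const_mul]
    refine setIntegral_congr_fun measurableSet_Ioo fun s hs => ?_
    simp only [hrw]
    rw [integral_const_mul, (integral_outerWeight_div_sqrt hp hs).2, smul_eq_mul]
    ring

theorem inner₁_eq (k s : ℝ) : inner₁ V₁ k s = inner₀ V₁ (1 - k) s := by
  rw [inner₀, inner₁, sub_right_comm]

/-- The reflection `k ↦ 1 - k` turns the second term into the first with `x` and `y` exchanged, so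
only the first needs analysis. -/
theorem outer₁_eq (x y k : ℝ) : outer₁ V₁ x y k = outer₀ V₁ y x (1 - k) := by
  simp only [outer₀, outer₁, inner₁_eq, sub_sub_cancel]
  congr 3
  ring

theorem mem_triangle_swap {p : ℝ × ℝ} : p.swap ∈ triangle ↔ p ∈ triangle := by
  simp only [triangle, mem_ofPred, Prod.fst_swap, Prod.snd_swap, add_comm p.2 p.1]
  tauto

theorem abelFormulaConverges (hα : α < 1) (hf₀ : IsWeightedContinuous α (deriv V₀))
    (hfc₀ : ContinuousOn (deriv V₀) (Ioo 0 1)) (hf₁ : IsWeightedContinuous α (deriv V₁))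
    (hfc₁ : ContinuousOn (deriv V₁) (Ioo 0 1)) : AbelFormulaConverges V₀ V₁ where
  integrable_inner₀ _ hk := intervalIntegrable_inner₀ hα hf₀ hfc₀ hk
  integrable_inner₁ k hk := by
    have h : 1 - k ∈ Ico (0 : ℝ) 1 := ⟨by linarith [hk.2], by linarith [hk.1]⟩
    exact (intervalIntegrable_inner₀ hα hf₁ hfc₁ h).congr fun s _ => (inner₁_eq k s).symm
  integrable_outer₀ _ hp := (integral_outer₀ hα hf₀ hp).1
  integrable_outer₁ p hp := by
    have h := ((integral_outer₀ hα hf₁ (mem_triangle_swap.2 hp)).1.comp_sub_left 1).symm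
    simp only [sub_zero, Prod.fst_swap, Prod.snd_swap] at h
    exact h.congr fun k _ => (outer₁_eq p.1 p.2 k).symm

theorem abelFormula_eq (hα : α < 1) (hf₀ : IsWeightedContinuous α (deriv V₀))
    (hf₁ : IsWeightedContinuous α (deriv V₁)) {p : ℝ × ℝ} (hp : p ∈ triangle) :
    abelFormula V₀ V₁ p =
      kernelIntegral (deriv V₀) kernel p + kernelIntegral (deriv V₁) kernel p.swap := by
  have h0 := (integral_outer₀ hα hf₀ hp).2
  have h1 := (integral_outer₀ hα hf₁ (mem_triangle_swap.2 hp)).2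
  simp only [Prod.fst_swap, Prod.snd_swap] at h1
  have h2 := intervalIntegral.integral_comp_sub_left (a := 1 - p.2) (b := 1)
    (outer₀ V₁ p.2 p.1) 1
  rw [sub_self, sub_sub_cancel, h1] at h2
  simp only [abelFormula, outer₁_eq]
  rw [h0, h2]
  field_simp [Real.pi_ne_zero]

end Fubini

/-! ### The formula solves the Goursat problem. -/

section Existence

variable {α : ℝ} {V₀ V₁ : ℝ → ℝ}

theorem contDiffOn_deriv_of_isAdmissibleData {n : ℕ} (hn : 2 ≤ n) {v : ℝ → ℝ}
    (hv : IsAdmissibleData n α v) : ContDiffOn ℝ (n - 1 : ℕ) (deriv v) (Ioo 0 1) := by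
  refine hv.contDiffOn.deriv_of_isOpen isOpen_Ioo ?_
  norm_cast
  omega

theorem integral_deriv_eq (hα : α < 1) {n : ℕ} (hn : 2 ≤ n) {v : ℝ → ℝ}
    (hv : IsAdmissibleData n α v) {x : ℝ} (hx : x ∈ Ico (0 : ℝ) 1) :
    ∫ s in (0 : ℝ)..x, deriv v s = v x := by
  have hw : IsWeightedContinuous α (deriv v) := hv.weighted_deriv
  have hn0 : (n : WithTop ℕ∞) ≠ 0 := by norm_cast; omega
  rw [intervalIntegral.integral_eq_sub_of_hasDerivAt_of_le hx.1
    (hv.continuousOn.mono fun s hs => ⟨hs.1, hs.2.trans_lt hx.2⟩)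
    (fun s hs => ?_) (hw.intervalIntegrable hα hx.1 hx.2), hv.zero, sub_zero]
  exact ((hv.contDiffOn.differentiableOn hn0).differentiableAt
    (isOpen_Ioo.mem_nhds ⟨hs.1, hs.2.trans hx.2⟩)).hasDerivAt

theorem kernelIntegral_zero_right (f : ℝ → ℝ) {x : ℝ} (hx : x ∈ Ico (0 : ℝ) 1) :
    kernelIntegral f kernel (x, 0) = ∫ s in (0 : ℝ)..x, f s := by
  refine intervalIntegral.integral_congr fun s hs => ?_
  rw [uIcc_of_le hx.1] at hs
  have := kernel_zero (mem_kernelDomain_of_mem_triangle (x := x) (y := 0) (s := s)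
    ⟨hx.1, le_rfl, by simpa using hx.2⟩ hs.2)
  simp [this]

theorem kernelIntegral_zero_left (f : ℝ → ℝ) (G : ℝ × ℝ × ℝ → ℝ) (y : ℝ) :
    kernelIntegral f G (0, y) = 0 := by
  simp [kernelIntegral]

theorem kernelIntegral_equation (hα : α < 1) {f : ℝ → ℝ} (hf : IsWeightedContinuous α f)
    {x y : ℝ} (hp : (x, y) ∈ triangle) :
    2 * (1 - x - y) * kernelIntegral f kernelXY (x, y) =
      kernelIntegral f kernelX (x, y) + kernelIntegral f kernelY (x, y) := by
  have hmem := mem_kernelDomain_of_mem_triangle hp le_rfl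
  simp only [kernelIntegral]
  rw [← intervalIntegral.integral_add
    (intervalIntegrable_smul_kernel hα hf (contDiffOn_kernelX 0).continuousOn hp.1 hmem)
    (intervalIntegrable_smul_kernel hα hf (contDiffOn_kernelY 0).continuousOn hp.1 hmem),
    ← intervalIntegral.integral_const_mul]
  refine intervalIntegral.integral_congr fun s hs => ?_
  rw [uIcc_of_le hp.1] at hs
  have := kernel_equation (mem_kernelDomain_of_mem_triangle hp hs.2)
  simp only [smul_eq_mul]
  linear_combination f s * this

/-- The solution as a sum of single integrals against the kernel. -/
def kernelSolution (f g : ℝ → ℝ) (p : ℝ × ℝ) : ℝ :=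
  kernelIntegral f kernel p + kernelIntegral g kernel p.swap

/-- The derivative of `kernelSolution` in `x`. -/
def kernelSolutionX (f g : ℝ → ℝ) (p : ℝ × ℝ) : ℝ :=
  f p.1 * kernel (p.1, p.2, p.1) + kernelIntegral f kernelX p + kernelIntegral g kernelY p.swap

/-- The mixed derivative of `kernelSolution`. -/
def kernelSolutionXY (f g : ℝ → ℝ) (p : ℝ × ℝ) : ℝ :=
  f p.1 * kernelY (p.1, p.2, p.1) + kernelIntegral f kernelXY p +
    (g p.2 * kernelY (p.2, p.1, p.2) + kernelIntegral g kernelXY p.swap)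

theorem kernelSolution_swap (f g : ℝ → ℝ) (p : ℝ × ℝ) :
    kernelSolution f g p = kernelSolution g f p.swap := by
  simp [kernelSolution, add_comm]

section Derivatives

variable {f g : ℝ → ℝ} {x y : ℝ}

theorem hasDerivAt_kernelSolution_fst (hα : α < 1) (hf : IsWeightedContinuous α f)
    (hg : IsWeightedContinuous α g) (hf1 : ContDiffOn ℝ 1 f (Ioo 0 1))
    (hp : (x, y) ∈ interior triangle) :
    HasDerivAt (fun x => kernelSolution f g (x, y)) (kernelSolutionX f g (x, y)) x := by
  have hp' := interior_subset hp
  exact (hasDerivAt_kernelIntegral_fst hα hf hf1 (by simpa using contDiffOn_kernel 1)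
    (contDiffOn_kernelX 0).continuousOn (fun _ _ _ h => hasDerivAt_kernel_fst h) hp'
    (mem_interior_triangle.1 hp).1).add
    (hasDerivAt_kernelIntegral_snd hα hg (contDiffOn_kernel 0).continuousOn
      (contDiffOn_kernelY 0).continuousOn (fun _ _ _ h => hasDerivAt_kernel_snd h)
      (mem_triangle_swap.2 hp'))

theorem mem_interior_triangle_swap {p : ℝ × ℝ} :
    p.swap ∈ interior triangle ↔ p ∈ interior triangle := by
  simp only [mem_interior_triangle, Prod.fst_swap, Prod.snd_swap, add_comm p.2 p.1]
  tauto

theorem hasDerivAt_kernelSolution_snd (hα : α < 1) (hf : IsWeightedContinuous α f)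
    (hg : IsWeightedContinuous α g) (hg1 : ContDiffOn ℝ 1 g (Ioo 0 1))
    (hp : (x, y) ∈ interior triangle) :
    HasDerivAt (fun y => kernelSolution f g (x, y)) (kernelSolutionX g f (y, x)) y := by
  simp only [kernelSolution_swap f g]
  exact hasDerivAt_kernelSolution_fst hα hg hf hg1 (mem_interior_triangle_swap.2 hp)

theorem hasDerivAt_kernelSolutionX_snd (hα : α < 1) (hf : IsWeightedContinuous α f)
    (hg : IsWeightedContinuous α g) (hg1 : ContDiffOn ℝ 1 g (Ioo 0 1))
    (hp : (x, y) ∈ interior triangle) :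
    HasDerivAt (fun y => kernelSolutionX f g (x, y)) (kernelSolutionXY f g (x, y)) y := by
  have hp' := interior_subset hp
  exact (((hasDerivAt_kernel_snd (mem_kernelDomain_of_mem_triangle hp' le_rfl)).const_mul
      (f x)).add
    (hasDerivAt_kernelIntegral_snd hα hf (contDiffOn_kernelX 0).continuousOn
      (contDiffOn_kernelXY 0).continuousOn (fun _ _ _ h => hasDerivAt_kernelX_snd h) hp')).add
    (hasDerivAt_kernelIntegral_fst hα hg hg1 (by simpa using contDiffOn_kernelY 1)
      (contDiffOn_kernelXY 0).continuousOn (fun _ _ _ h => hasDerivAt_kernelY_fst h)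
      (mem_triangle_swap.2 hp') (mem_interior_triangle.1 hp).2.1)

/-- The integral terms satisfy the equation because the kernel does; the remaining terms, multiples
of `f x` and `g y`, cancel by the diagonal identity `two_mul_profileY`. -/
theorem kernelSolution_equation (hα : α < 1) (hf : IsWeightedContinuous α f)
    (hg : IsWeightedContinuous α g) (hp : (x, y) ∈ interior triangle) :
    kernelSolutionXY f g (x, y) -
      (kernelSolutionX f g (x, y) + kernelSolutionX g f (y, x)) / (2 * (1 - x - y)) = 0 := by
  obtain ⟨h1, h2, h3⟩ := mem_interior_triangle.1 hp
  dsimp only at h1 h2 h3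
  have e1 := kernelIntegral_equation hα hf (interior_subset hp)
  have e2 := kernelIntegral_equation hα hg (mem_triangle_swap.2 (interior_subset hp))
  have e3 := two_mul_profileY (p := (x, y)) ⟨by simp only; linarith, h3⟩
  have e4 := two_mul_profileY (p := (y, x)) ⟨by simp only; linarith, by simp only; linarith⟩
  have hne : 2 * (1 - x - y) ≠ 0 := by
    have : 0 < 1 - x - y := by linarith
    positivity
  rw [sub_eq_zero, eq_div_iff hne]
  simp only [kernelSolutionXY, kernelSolutionX, kernel_diag, kernelY_diag, Prod.swap_prod_mk]
    at e2 e3 e4 ⊢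
  linear_combination e1 + e2 + f x * e3 + g y * e4

/-- Only the term `f x * K(x,y,x)` is singular, and the factor `x ^ α` compensates it; the two
integral terms are already continuous on the triangle. -/
theorem weighted_kernelSolutionX (hα0 : 0 ≤ α) (hα : α < 1) (hf : IsWeightedContinuous α f)
    (hg : IsWeightedContinuous α g) :
    ExtendsContinuously (fun p : ℝ × ℝ => p.1 ^ α * kernelSolutionX f g p)
      (interior triangle) triangle := by
  obtain ⟨f', hf', he⟩ := hf
  have hkernel : ContinuousOn (fun p : ℝ × ℝ => kernel (p.1, p.2, p.1)) triangle :=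
    (contDiffOn_kernel 0).continuousOn.comp (f := fun p : ℝ × ℝ => (p.1, p.2, p.1))
      (by fun_prop) fun p hp => mem_kernelDomain_of_mem_triangle hp le_rfl
  have hrpow : ContinuousOn (fun p : ℝ × ℝ => p.1 ^ α) triangle :=
    (continuous_fst.rpow_const fun p => Or.inr hα0).continuousOn
  refine ⟨fun p => f' p.1 * kernel (p.1, p.2, p.1) +
    p.1 ^ α * (kernelIntegral f kernelX p + kernelIntegral g kernelY p.swap), ?_, ?_⟩
  · refine ((hf'.comp continuousOn_fst fun p hp => ?_).mul hkernel).add (hrpow.mul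
      ((continuousOn_kernelIntegral hα ⟨f', hf', he⟩ (contDiffOn_kernelX 0).continuousOn).add
      ((continuousOn_kernelIntegral hα hg (contDiffOn_kernelY 0).continuousOn).comp
        continuous_swap.continuousOn fun p hp => mem_triangle_swap.2 hp)))
    exact ⟨hp.1, by have := hp.2.1; have := hp.2.2; linarith⟩
  · intro p hp
    obtain ⟨h1, h2, h3⟩ := mem_interior_triangle.1 hp
    have := he (x := p.1) ⟨h1, by linarith⟩
    simp only [kernelSolutionX, this]
    ring

end Derivatives

theorem ExtendsContinuously.congr {X : Type*} [TopologicalSpace X] {f g : X → ℝ} {U S : Set X}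
    (hf : ExtendsContinuously f U S) (h : EqOn f g U) : ExtendsContinuously g U S :=
  let ⟨e, he, heq⟩ := hf
  ⟨e, he, heq.trans h⟩

theorem isGoursatSolutionWith_abelFormula (hα : α ∈ Ico (0 : ℝ) 1) {n : ℕ} (hn : 2 ≤ n)
    (hV₀ : IsAdmissibleData n α V₀) (hV₁ : IsAdmissibleData n α V₁) :
    IsGoursatSolutionWith (n - 1) α V₀ V₁ (abelFormula V₀ V₁) := by
  have hf : IsWeightedContinuous α (deriv V₀) := hV₀.weighted_deriv
  have hg : IsWeightedContinuous α (deriv V₁) := hV₁.weighted_deriv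
  have hfm := contDiffOn_deriv_of_isAdmissibleData hn hV₀
  have hgm := contDiffOn_deriv_of_isAdmissibleData hn hV₁
  -- Here `n ≥ 2` enters: the densities `V₀'` and `V₁'` are `C¹`, as differentiation along the
  -- diagonal requires.
  have hn1 : (1 : WithTop ℕ∞) ≤ (n - 1 : ℕ) := by norm_cast; omega
  have hf1 := hfm.of_le hn1
  have hg1 := hgm.of_le hn1
  set f := deriv V₀ with hfdef
  set g := deriv V₁ with hgdef
  have heq : EqOn (abelFormula V₀ V₁) (kernelSolution f g) triangle := fun p hp =>
    abelFormula_eq hα.2 hf hg hp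
  have hX : ∀ p ∈ interior triangle,
      HasDerivAt (fun s => abelFormula V₀ V₁ (s, p.2)) (kernelSolutionX f g p) p.1 := by
    rintro ⟨x, y⟩ hp
    refine (hasDerivAt_kernelSolution_fst hα.2 hf hg hf1 hp).congr_of_eventuallyEq ?_
    have : ContinuousAt (fun s : ℝ => (s, y)) x := by fun_prop
    filter_upwards [this.eventually (isOpen_interior.mem_nhds hp)] with s hs
    exact heq (interior_subset hs)
  have hY : ∀ p ∈ interior triangle,
      HasDerivAt (fun t => abelFormula V₀ V₁ (p.1, t)) (kernelSolutionX g f p.swap) p.2 := by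
    rintro ⟨x, y⟩ hp
    refine (hasDerivAt_kernelSolution_snd hα.2 hf hg hg1 hp).congr_of_eventuallyEq ?_
    have : ContinuousAt (fun t : ℝ => (x, t)) y := by fun_prop
    filter_upwards [this.eventually (isOpen_interior.mem_nhds hp)] with t ht
    exact heq (interior_subset ht)
  have hdx : EqOn (dx (abelFormula V₀ V₁)) (kernelSolutionX f g) (interior triangle) :=
    fun p hp => (hX p hp).deriv
  have hdy : EqOn (dy (abelFormula V₀ V₁)) (fun p => kernelSolutionX g f p.swap)
      (interior triangle) := fun p hp => (hY p hp).deriv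
  have hXY : ∀ p ∈ interior triangle,
      HasDerivAt (fun t => dx (abelFormula V₀ V₁) (p.1, t)) (kernelSolutionXY f g p) p.2 := by
    rintro ⟨x, y⟩ hp
    refine (hasDerivAt_kernelSolutionX_snd hα.2 hf hg hg1 hp).congr_of_eventuallyEq ?_
    have : ContinuousAt (fun t : ℝ => (x, t)) y := by fun_prop
    filter_upwards [this.eventually (isOpen_interior.mem_nhds hp)] with t ht
    exact hdx ht
  have hdxy : EqOn (dxy (abelFormula V₀ V₁)) (kernelSolutionXY f g) (interior triangle) :=
    fun p hp => (hXY p hp).deriv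
  have hequation : ∀ p ∈ interior triangle, dxy (abelFormula V₀ V₁) p -
      (dx (abelFormula V₀ V₁) p + dy (abelFormula V₀ V₁) p) / (2 * (1 - p.1 - p.2)) = 0 := by
    intro p hp
    rw [hdxy hp, hdx hp, hdy hp]
    exact kernelSolution_equation hα.2 hf hg hp
  have hwx : ExtendsContinuously (fun p : ℝ × ℝ => p.1 ^ α * dx (abelFormula V₀ V₁) p)
      (interior triangle) triangle :=
    (weighted_kernelSolutionX hα.1 hα.2 hf hg).congr fun p hp => by simp only [hdx hp]
  have hwy : ExtendsContinuously (fun p : ℝ × ℝ => p.2 ^ α * dy (abelFormula V₀ V₁) p)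
      (interior triangle) triangle := by
    obtain ⟨e, he, he'⟩ := weighted_kernelSolutionX hα.1 hα.2 hg hf
    refine ⟨fun p => e p.swap, he.comp continuous_swap.continuousOn
      fun p hp => mem_triangle_swap.2 hp, fun p hp => ?_⟩
    dsimp only
    rw [he' (mem_interior_triangle_swap.2 hp), hdy hp]
    rfl
  have hswap : MapsTo Prod.swap triangle triangle := fun p hp => mem_triangle_swap.2 hp
  refine ⟨?_, ?_, fun p hp => (hX p hp).differentiableAt, fun p hp => (hY p hp).differentiableAt,
    fun p hp => (hXY p hp).differentiableAt, hequation, hwx, hwy, ?_, ?_, ?_⟩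
  · refine ContinuousOn.congr ?_ heq
    exact (continuousOn_kernelIntegral hα.2 hf (contDiffOn_kernel 0).continuousOn).add
      ((continuousOn_kernelIntegral hα.2 hg (contDiffOn_kernel 0).continuousOn).comp
        continuous_swap.continuousOn hswap)
  · refine ContDiffOn.congr ?_ (heq.mono interior_subset)
    exact (contDiffOn_kernelIntegral hα.2 hf hfm (contDiffOn_kernel _)).add
      ((contDiffOn_kernelIntegral hα.2 hg hgm (contDiffOn_kernel _)).comp
        (f := Prod.swap) (contDiff_snd.prodMk contDiff_fst).contDiffOn
        fun p hp => mem_interior_triangle_swap.2 hp)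
  · obtain ⟨e₁, he₁, he₁'⟩ := hwx
    obtain ⟨e₂, he₂, he₂'⟩ := hwy
    -- The equation expresses `V_xy` through `V_x` and `V_y`, so the extension comes from those
    -- already found.
    refine ⟨fun p => (p.2 ^ α * e₁ p + p.1 ^ α * e₂ p) / (2 * (1 - p.1 - p.2)), ?_, ?_⟩
    · refine ContinuousOn.div ?_ (by fun_prop) fun p hp => ?_
      · exact ((continuous_snd.rpow_const fun p => Or.inr hα.1).continuousOn.mul he₁).add
          ((continuous_fst.rpow_const fun p => Or.inr hα.1).continuousOn.mul he₂)
      · have h := hp.2.2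
        have : 0 < 1 - p.1 - p.2 := by linarith
        positivity
    · intro p hp
      dsimp only
      rw [he₁' hp, he₂' hp, sub_eq_zero.1 (hequation p hp)]
      ring
  · intro x hx
    have hp : (x, (0 : ℝ)) ∈ triangle := ⟨hx.1, le_rfl, by simpa using hx.2⟩
    rw [heq hp, kernelSolution, Prod.swap_prod_mk, kernelIntegral_zero_left, add_zero,
      kernelIntegral_zero_right _ hx, integral_deriv_eq hα.2 hn hV₀ hx]
  · intro y hy
    have hp : ((0 : ℝ), y) ∈ triangle := ⟨le_rfl, hy.1, by simpa using hy.2⟩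
    rw [heq hp, kernelSolution, Prod.swap_prod_mk, kernelIntegral_zero_left, zero_add,
      kernelIntegral_zero_right _ hy, integral_deriv_eq hα.2 hn hV₁ hy]

end Existence

/-! ### Uniqueness: the homogeneous problem. -/

section Homogeneous

variable {Z e : ℝ × ℝ → ℝ}

/-- If `Z` vanishes on the `x`-axis, so does any continuous extension of `Z_x`. -/
theorem extension_dx_eq_zero (hc : ContinuousOn Z triangle)
    (hx : ∀ p ∈ interior triangle, HasDerivAt (fun s => Z (s, p.2)) (e p) p.1)
    (he : ContinuousOn e {p | p ∈ triangle ∧ 0 < p.1})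
    (h0 : ∀ x ∈ Ico (0 : ℝ) 1, Z (x, 0) = 0) {x : ℝ} (hx0 : 0 < x) (hx1 : x < 1) :
    e (x, 0) = 0 := by
  by_contra hne
  set c := e (x, 0) with hcdef
  have hcpos : 0 < |c| / 2 := by positivity
  have hmem : (x, (0 : ℝ)) ∈ {p : ℝ × ℝ | p ∈ triangle ∧ 0 < p.1} :=
    ⟨⟨hx0.le, le_rfl, by simpa using hx1⟩, hx0⟩
  obtain ⟨r, hr, hball⟩ := Metric.continuousOn_iff.1 he _ hmem _ hcpos
  -- Small enough for the square `[x, x + ρ] × (0, ρ)` to lie both in the triangle and in the ball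
  -- where `e` is within `|c| / 2` of `c`.
  set ρ := min r (1 - x) / 4 with hρ
  have hmin : 0 < min r (1 - x) := lt_min hr (by linarith)
  have hρ0 : 0 < ρ := by positivity
  have hρr : ρ < r := by have := min_le_left r (1 - x); linarith
  have hρ1 : x + 2 * ρ < 1 := by have := min_le_right r (1 - x); linarith
  -- By the mean value theorem the increment of `Z` is nearly `c ρ`. As `y → 0` both values of `Z`
  -- tend to `0`, leaving `|c| ρ ≤ |c| ρ / 2`.
  have hsq : ∀ y ∈ Ioo (0 : ℝ) ρ, |Z (x + ρ, y) - Z (x, y) - c * ρ| ≤ |c| / 2 * ρ := by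
    intro y hy
    have htri : ∀ s ∈ Icc x (x + ρ), (s, y) ∈ interior triangle := fun s hs =>
      mem_interior_triangle.2 ⟨by linarith [hs.1], hy.1, by linarith [hs.2, hy.2]⟩
    obtain ⟨ξ, hξ, hslope⟩ := exists_hasDerivAt_eq_slope (fun s => Z (s, y)) (fun s => e (s, y))
      (by linarith : x < x + ρ)
      (fun s hs => (hx _ (htri s hs)).continuousAt.continuousWithinAt)
      (fun s hs => hx _ (htri s (Ioo_subset_Icc_self hs)))
    have hξ' := htri ξ (Ioo_subset_Icc_self hξ)
    have hdist : dist (ξ, y) (x, (0 : ℝ)) < r := by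
      rw [Prod.dist_eq, max_lt_iff, Real.dist_eq, Real.dist_eq, abs_of_pos (by linarith [hξ.1]),
        abs_of_pos (by linarith [hy.1])]
      exact ⟨by linarith [hξ.2], by linarith [hy.2]⟩
    have h1 := hball (ξ, y) ⟨interior_subset hξ', (mem_interior_triangle.1 hξ').1⟩ hdist
    rw [Real.dist_eq] at h1
    rw [add_sub_cancel_left, eq_div_iff hρ0.ne'] at hslope
    rw [← hslope, ← sub_mul, abs_mul, abs_of_pos hρ0]
    exact mul_le_mul_of_nonneg_right h1.le hρ0.le
  have hlim : ∀ s ∈ Icc x (x + ρ), Tendsto (fun y => Z (s, y)) (𝓝[>] 0) (𝓝 0) := by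
    intro s hs
    have hst : (s, (0 : ℝ)) ∈ triangle :=
      ⟨by linarith [hs.1], le_rfl, by simp only [add_zero]; linarith [hs.2]⟩
    have h1 := hc _ hst
    have h2 : Tendsto (fun y : ℝ => (s, y)) (𝓝[>] 0) (𝓝[triangle] (s, 0)) := by
      refine tendsto_nhdsWithin_iff.2 ⟨?_, ?_⟩
      · exact (Continuous.tendsto (f := fun y : ℝ => (s, y)) (by fun_prop) 0).mono_left
          nhdsWithin_le_nhds
      · filter_upwards [Ioo_mem_nhdsGT hρ0] with y hy
        exact ⟨by linarith [hs.1], hy.1.le, by linarith [hs.2, hy.2]⟩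
    have h3 := h1.tendsto.comp h2
    rwa [h0 s ⟨by linarith [hs.1], by linarith [hs.2]⟩] at h3
  have hl := (((hlim (x + ρ) ⟨by linarith, le_rfl⟩).sub
    (hlim x ⟨le_rfl, by linarith⟩)).sub_const (c * ρ)).abs
  have h4 := le_of_tendsto hl (by
    filter_upwards [Ioo_mem_nhdsGT hρ0] with y hy using hsq y hy)
  rw [sub_zero, zero_sub, abs_neg, abs_mul, abs_of_pos hρ0] at h4
  have : 0 < |c| * ρ := by positivity
  linarith

/-- For a solution with zero data on the `x`-axis, `Z_x` is controlled by `Z` on the vertical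
segment below. -/
theorem abs_dx_le (hc : ContinuousOn Z triangle) {d : ℝ × ℝ → ℝ}
    (hx : ∀ p ∈ interior triangle, HasDerivAt (fun s => Z (s, p.2)) (e p) p.1)
    (hy : ∀ p ∈ interior triangle, HasDerivAt (fun t => Z (p.1, t)) (d p) p.2)
    (hxy : ∀ p ∈ interior triangle, HasDerivAt (fun t => e (p.1, t))
      ((e p + d p) / (2 * (1 - p.1 - p.2))) p.2)
    (he : ContinuousOn e {p | p ∈ triangle ∧ 0 < p.1})
    (h0 : ∀ x ∈ Ico (0 : ℝ) 1, Z (x, 0) = 0) {x y σ M : ℝ} (hp : (x, y) ∈ interior triangle)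
    (hσ : 0 < σ) (hσ' : σ ^ 2 ≤ 1 - x - y) (hM : ∀ t ∈ Icc 0 y, |Z (x, t)| ≤ M) :
    |e (x, y)| ≤ (1 / (4 * σ ^ 4) + 1 / (2 * σ ^ 2)) * M := by
  obtain ⟨h1, h2, h3⟩ := mem_interior_triangle.1 hp
  dsimp only at h1 h2 h3
  have hM0 : 0 ≤ M := (abs_nonneg _).trans (hM y ⟨h2.le, le_rfl⟩)
  have htri : ∀ t ∈ Icc 0 y, (x, t) ∈ triangle := fun t ht =>
    ⟨h1.le, ht.1, by linarith [ht.2]⟩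
  have htri' : ∀ t ∈ Ioo 0 y, (x, t) ∈ interior triangle := fun t ht =>
    mem_interior_triangle.2 ⟨h1, ht.1, by linarith [ht.2]⟩
  have hroot : ∀ t ∈ Icc 0 y, σ ≤ √(1 - x - t) := fun t ht =>
    Real.le_sqrt_of_sq_le (by linarith [ht.2])
  -- The root is the integrating factor for the term in `Z_x`, and subtracting the second term
  -- absorbs `Z_y`: the derivative of `E` involves `Z` alone.
  set E : ℝ → ℝ := fun t => √(1 - x - t) * e (x, t) - Z (x, t) / (2 * √(1 - x - t)) with hE
  have hEc : ContinuousOn E (Icc 0 y) := by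
    refine ContinuousOn.sub (ContinuousOn.mul (by fun_prop) ?_) (ContinuousOn.div ?_ (by fun_prop)
      fun t ht => ?_)
    · exact he.comp (f := fun t : ℝ => (x, t)) (by fun_prop) fun t ht => ⟨htri t ht, h1⟩
    · exact hc.comp (f := fun t : ℝ => (x, t)) (by fun_prop) htri
    · have := hσ.trans_le (hroot t ht)
      positivity
  have hEd : ∀ t ∈ Ioo 0 y, HasDerivAt E
      (-(Z (x, t) / (4 * √(1 - x - t) ^ 3))) t := by
    intro t ht
    have ha : 0 < 1 - x - t := by linarith [ht.2]
    have hs : 0 < √(1 - x - t) := Real.sqrt_pos.2 ha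
    have hsq : √(1 - x - t) ^ 2 = 1 - x - t := Real.sq_sqrt ha.le
    have k1 := ((hasDerivAt_id t).const_sub (1 - x)).sqrt ha.ne'
    refine ((k1.mul (hxy _ (htri' t ht))).sub ((hy _ (htri' t ht)).div (k1.const_mul 2)
      (by simp only [id]; positivity))).congr_deriv ?_
    simp only [id]
    rw [← hsq]
    simp only [Real.sqrt_sq hs.le]
    generalize √(1 - x - t) = A at hs
    field_simp
    ring
  obtain ⟨ξ, hξ, hslope⟩ := exists_hasDerivAt_eq_slope E _ h2 hEc hEd
  have hE0 : E 0 = 0 := by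
    simp only [hE, extension_dx_eq_zero hc hx he h0 h1 (by linarith : x < 1),
      h0 x ⟨h1.le, by linarith⟩]
    simp
  rw [hE0, sub_zero, sub_zero, eq_div_iff h2.ne'] at hslope
  have hbound : |E y| ≤ M / (4 * σ ^ 3) := by
    rw [← hslope, abs_mul, abs_neg, abs_div, abs_of_pos h2]
    have hr := hroot ξ (Ioo_subset_Icc_self hξ)
    have hr0 := hσ.trans_le hr
    rw [abs_of_pos (by positivity : 0 < 4 * √(1 - x - ξ) ^ 3)]
    have h5 : |Z (x, ξ)| / (4 * √(1 - x - ξ) ^ 3) ≤ M / (4 * σ ^ 3) := by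
      gcongr
      exact hM ξ (Ioo_subset_Icc_self hξ)
    have h6 : 0 ≤ M / (4 * σ ^ 3) := by positivity
    -- The length `y` of the vertical segment is at most `1`.
    calc _ ≤ M / (4 * σ ^ 3) * 1 := by gcongr; linarith
      _ = _ := mul_one _
  have hr := hroot y ⟨h2.le, le_rfl⟩
  have hr0 := hσ.trans_le hr
  have hsol : e (x, y) = (E y + Z (x, y) / (2 * √(1 - x - y))) / √(1 - x - y) := by
    simp only [hE]
    field_simp
    ring
  rw [hsol, abs_div, abs_of_pos hr0]
  calc |E y + Z (x, y) / (2 * √(1 - x - y))| / √(1 - x - y)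
      ≤ (|E y| + |Z (x, y) / (2 * √(1 - x - y))|) / √(1 - x - y) := by
        gcongr; exact abs_add_le _ _
    _ ≤ (M / (4 * σ ^ 3) + M / (2 * σ)) / σ := by
        rw [abs_div, abs_of_pos (by positivity : 0 < 2 * √(1 - x - y))]
        gcongr
        exact hM y ⟨h2.le, le_rfl⟩
    _ = _ := by field_simp

/-- On the rectangle below a given point, `abs_dx_le` holds with one constant `C`. Let `N` be the
maximum there of `|Z| exp(-2Cx)`. Then `|Z_x| ≤ C N exp(2Cx)`, and comparison from `Z(0, y) = 0`
halves the bound: `N ≤ N / 2`. -/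
theorem eqOn_zero_of_homogeneous (hc : ContinuousOn Z triangle) {d : ℝ × ℝ → ℝ}
    (hx : ∀ p ∈ interior triangle, HasDerivAt (fun s => Z (s, p.2)) (e p) p.1)
    (hy : ∀ p ∈ interior triangle, HasDerivAt (fun t => Z (p.1, t)) (d p) p.2)
    (hxy : ∀ p ∈ interior triangle, HasDerivAt (fun t => e (p.1, t))
      ((e p + d p) / (2 * (1 - p.1 - p.2))) p.2)
    (he : ContinuousOn e {p | p ∈ triangle ∧ 0 < p.1})
    (h0 : ∀ x ∈ Ico (0 : ℝ) 1, Z (x, 0) = 0) (h1 : ∀ y ∈ Ico (0 : ℝ) 1, Z (0, y) = 0) :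
    ∀ p ∈ triangle, Z p = 0 := by
  rintro ⟨x₀, y₀⟩ ⟨hx₀, hy₀, hxy₀⟩
  dsimp only at hx₀ hy₀ hxy₀
  set σ := √(1 - x₀ - y₀) with hσdef
  have hσ : 0 < σ := Real.sqrt_pos.2 (by linarith)
  have hσ2 : σ ^ 2 = 1 - x₀ - y₀ := Real.sq_sqrt (by linarith)
  set C := 1 / (4 * σ ^ 4) + 1 / (2 * σ ^ 2) with hC
  have hCpos : 0 < C := by positivity
  have htri : ∀ p ∈ Icc 0 x₀ ×ˢ Icc 0 y₀, p ∈ triangle := fun p hp =>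
    ⟨hp.1.1, hp.2.1, by linarith [hp.1.2, hp.2.2]⟩
  have hcomp : IsCompact (Icc 0 x₀ ×ˢ Icc 0 y₀) := isCompact_Icc.prod isCompact_Icc
  obtain ⟨q, hq, hmax⟩ := hcomp.exists_isMaxOn
    (f := fun p : ℝ × ℝ => |Z p| * Real.exp (-(2 * C * p.1)))
    ⟨(0, 0), ⟨le_rfl, hx₀⟩, ⟨le_rfl, hy₀⟩⟩ ((hc.mono htri).abs.mul (by fun_prop))
  set N := |Z q| * Real.exp (-(2 * C * q.1)) with hN
  have hN0 : 0 ≤ N := by positivity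
  have hZN : ∀ p ∈ Icc 0 x₀ ×ˢ Icc 0 y₀, |Z p| ≤ N * Real.exp (2 * C * p.1) := by
    intro p hp
    have h2 : |Z p| * Real.exp (-(2 * C * p.1)) ≤ N := hmax hp
    rw [Real.exp_neg, ← div_eq_mul_inv, div_le_iff₀ (Real.exp_pos _)] at h2
    exact h2
  have hhalf : ∀ p ∈ Icc 0 x₀ ×ˢ Icc 0 y₀, |Z p| ≤ N / 2 * Real.exp (2 * C * p.1) := by
    rintro ⟨x, y⟩ hp
    have hp' := hp
    obtain ⟨⟨hx1, hx2⟩, hy1, hy2⟩ := hp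
    dsimp only at hx1 hx2 hy1 hy2 ⊢
    have hnn : 0 ≤ N / 2 * Real.exp (2 * C * x) := by positivity
    rcases eq_or_lt_of_le hy1 with hy3 | hy3
    · rwa [← hy3, h0 x ⟨hx1, by linarith⟩, abs_zero]
    have hZ0 : Z (0, y) = 0 := h1 y ⟨hy1, by linarith⟩
    have hint : ∀ s ∈ Ioo 0 x, (s, y) ∈ interior triangle := fun s hs =>
      mem_interior_triangle.2 ⟨hs.1, hy3, by linarith [hs.2]⟩
    have hd : ∀ s ∈ Ioo 0 x, |e (s, y)| ≤ N * C * Real.exp (2 * C * s) := by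
      intro s hs
      have := abs_dx_le hc hx hy hxy he h0 (M := N * Real.exp (2 * C * s)) (hint s hs) hσ
        (by linarith [hs.2]) (fun t ht => hZN (s, t)
          ⟨⟨hs.1.le, hs.2.le.trans hx2⟩, ht.1, ht.2.trans hy2⟩)
      exact this.trans_eq (by rw [← hC]; ring)
    have hexp : ∀ s, HasDerivAt (fun s => N / 2 * Real.exp (2 * C * s))
        (N * C * Real.exp (2 * C * s)) s := fun s => by
      refine ((((hasDerivAt_id s).const_mul (2 * C)).exp).const_mul (N / 2)).congr_deriv ?_
      simp only [id]
      ring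
    have hZc : ContinuousOn (fun s => Z (s, y)) (Icc 0 x) :=
      hc.comp (f := fun s : ℝ => (s, y)) (by fun_prop)
        fun s hs => ⟨hs.1, hy1, by linarith [hs.2]⟩
    -- Monotonicity for each sign `τ = ±1` replaces integration of `Z_x`; it needs the derivative
    -- only inside `(0, x)`, so `e` need not extend to `x = 0`.
    have mono : ∀ τ : ℝ, |τ| = 1 → τ * Z (x, y) ≤ N / 2 * Real.exp (2 * C * x) := by
      intro τ hτ
      have hm : MonotoneOn (fun s => N / 2 * Real.exp (2 * C * s) - τ * Z (s, y)) (Icc 0 x) := by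
        refine monotoneOn_of_hasDerivWithinAt_nonneg (convex_Icc _ _)
          (f' := fun s => N * C * Real.exp (2 * C * s) - τ * e (s, y))
          (ContinuousOn.sub (by fun_prop) (continuousOn_const.mul hZc)) ?_ ?_
        · intro s hs
          rw [interior_Icc] at hs ⊢
          exact ((hexp s).sub ((hx _ (hint s hs)).const_mul τ)).hasDerivWithinAt
        · intro s hs
          rw [interior_Icc] at hs
          have h3 := hd s hs
          have h4 := le_abs_self (τ * e (s, y))
          rw [abs_mul, hτ, one_mul] at h4
          linarith
      have h5 := hm ⟨le_rfl, hx1⟩ ⟨hx1, le_rfl⟩ hx1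
      simp only [hZ0, mul_zero, sub_zero, Real.exp_zero, mul_one] at h5
      linarith
    have h6 := mono 1 (by simp)
    have h7 := mono (-1) (by simp)
    exact abs_le.2 ⟨by linarith, by linarith⟩
  have hN' : N ≤ N / 2 := by
    have h2 := hhalf q hq
    calc N ≤ N / 2 * Real.exp (2 * C * q.1) * Real.exp (-(2 * C * q.1)) := by
          rw [hN] at h2 ⊢; gcongr
      _ = N / 2 := by rw [mul_assoc, ← Real.exp_add, add_neg_cancel, Real.exp_zero, mul_one]
  have hN1 : N = 0 := by linarith
  have h3 := hZN (x₀, y₀) ⟨⟨hx₀, le_rfl⟩, hy₀, le_rfl⟩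
  rw [hN1, zero_mul] at h3
  exact abs_nonpos_iff.1 h3

end Homogeneous

theorem continuousOn_rpow_neg_mul {α : ℝ} {g : ℝ × ℝ → ℝ} (hg : ContinuousOn g triangle) :
    ContinuousOn (fun p : ℝ × ℝ => p.1 ^ (-α) * g p) {p | p ∈ triangle ∧ 0 < p.1} :=
  (continuousOn_fst.rpow_const fun _ hp => Or.inl hp.2.ne').mul (hg.mono fun _ hp => hp.1)

theorem IsGoursatSolutionWith.eqOn {m m' : ℕ} {α β : ℝ} {V₀ V₁ : ℝ → ℝ} {V W : ℝ × ℝ → ℝ}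
    (hW : IsGoursatSolutionWith m α V₀ V₁ W) (hV : IsGoursatSolutionWith m' β V₀ V₁ V) :
    EqOn W V triangle := by
  obtain ⟨g, hg, hgW⟩ := hW.weighted_dx
  obtain ⟨k, hk, hkV⟩ := hV.weighted_dx
  -- The two solutions may have different exponents, so each extension is divided by its own power;
  -- the result is continuous where `x > 0`, including on the `x`-axis.
  set e : ℝ × ℝ → ℝ := fun p => p.1 ^ (-α) * g p - p.1 ^ (-β) * k p
  have he : EqOn e (fun p => dx W p - dx V p) (interior triangle) := by
    intro p hp
    have hp0 := (mem_interior_triangle.1 hp).1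
    simp only [e, hgW hp, hkV hp]
    rw [← mul_assoc, ← mul_assoc, ← Real.rpow_add hp0, ← Real.rpow_add hp0]
    simp
  have key := eqOn_zero_of_homogeneous (Z := fun p => W p - V p) (e := e)
    (d := fun p => dy W p - dy V p) (hW.continuousOn.sub hV.continuousOn) ?_ ?_ ?_
    ((continuousOn_rpow_neg_mul hg).sub (continuousOn_rpow_neg_mul hk)) ?_ ?_
  · exact fun p hp => sub_eq_zero.1 (key p hp)
  · intro p hp
    rw [he hp]
    exact (hW.exists_dx p hp).hasDerivAt.sub (hV.exists_dx p hp).hasDerivAt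
  · exact fun p hp => (hW.exists_dy p hp).hasDerivAt.sub (hV.exists_dy p hp).hasDerivAt
  · rintro ⟨x, y⟩ hp
    have h1 := (hW.exists_dxy _ hp).hasDerivAt.sub (hV.exists_dxy _ hp).hasDerivAt
    have h2 : (fun t => e (x, t)) =ᶠ[𝓝 y] fun t => dx W (x, t) - dx V (x, t) := by
      have : ContinuousAt (fun t : ℝ => (x, t)) y := by fun_prop
      filter_upwards [this.eventually (isOpen_interior.mem_nhds hp)] with t ht
      exact he ht
    refine (HasDerivAt.congr_of_eventuallyEq h1 h2).congr_deriv ?_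
    have e1 := sub_eq_zero.1 (hW.equation _ hp)
    have e2 := sub_eq_zero.1 (hV.equation _ hp)
    rw [he hp]
    change dxy W (x, y) - dxy V (x, y) = _
    rw [e1, e2]
    ring
  · exact fun x hx => sub_eq_zero.2 ((hW.boundary_x x hx).trans (hV.boundary_x x hx).symm)
  · exact fun y hy => sub_eq_zero.2 ((hW.boundary_y y hy).trans (hV.boundary_y y hy).symm)

end EulerDarboux

end

theorem theorem1 (n : ℕ) (hn : 2 ≤ n) (α : ℝ) (hα : α ∈ Set.Ico (0 : ℝ) 1) (V₀ V₁ : ℝ → ℝ)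
    (hV₀ : EulerDarboux.IsAdmissibleData n α V₀) (hV₁ : EulerDarboux.IsAdmissibleData n α V₁) :
    EulerDarboux.AbelFormulaConverges V₀ V₁ ∧
    EulerDarboux.IsGoursatSolutionWith (n - 1) α V₀ V₁ (EulerDarboux.abelFormula V₀ V₁) ∧
    EulerDarboux.IsGoursatSolution (n - 1) V₀ V₁ (EulerDarboux.abelFormula V₀ V₁) ∧
    ∀ (m : ℕ) (W : ℝ × ℝ → ℝ), EulerDarboux.IsGoursatSolution m V₀ V₁ W →
      Set.EqOn W (EulerDarboux.abelFormula V₀ V₁) EulerDarboux.triangle := by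
  have hV := EulerDarboux.isGoursatSolutionWith_abelFormula hα hn hV₀ hV₁
  refine ⟨EulerDarboux.abelFormulaConverges hα.2 hV₀.weighted_deriv
    (EulerDarboux.contDiffOn_deriv_of_isAdmissibleData hn hV₀).continuousOn hV₁.weighted_deriv
    (EulerDarboux.contDiffOn_deriv_of_isAdmissibleData hn hV₁).continuousOn,
    hV, ⟨α, hα, hV⟩, ?_⟩
  rintro m W ⟨β, -, hW⟩
  exact hW.eqOn hV
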